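/- Let $G$ be a finite group, let $R_0=1,R_1,\dots,R_n$ be its irreducible complex representations up to isomorphism ($R_0$ trivial), with characters $\chi_i$ and dimensions $d_i$, and let $g_C$ denote a representative of a conjugacy class $C$ of $G$. For a finite-dimensional representation $Q$ let $M[Q]$ be the matrix indexed by $0,\dots,n$ whose entry $M[Q]^i_j$ in row $i$ and column $j$ is the multiplicity of $R_j$ in $Q\otimes R_i$. Let $R:G\to GL(V)$ be a faithful representation, $\dim_{\mathbb C} V=d<\infty$, whose image acts freely: $R(g)v=v$ with $g\ne 1$ implies $v=0$ (so that $\det(E-R(g))\neq0$ for $g\ne1$). Put $M[R_S(q)]=\sum_{m\ge0}M[S^mR]\,q^m$ and $M[R_A(-q)]=\sum_{m=0}^{d}M[\Lambda^mR]\,(-q)^m$. Let $\widetilde M[R](q)$ be obtained from $M[R_A(-q)]$ by deleting the row and the column with index $0$; the matrix $\widetilde M[R](1)$ is the Euclidean Cartan matrix of $R$. Then $\widetilde M[R](1)$ is invertible, and $$\widetilde M[R](1)^{-1}=\frac1{|G|}\,\big(\chi_i(g_C)-d_i\big)_{i,C}\;\mathrm{diag}\Big(\frac{|C|}{\det(E-R(g_C))}\Big)_{C}\;\big(\overline{\chi_j(g_C)}-d_j\big)_{C,j},$$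 where $i,j=1,\dots,n$ and $C$ runs over the conjugacy classes different from $\{1\}$; that is, for $i,j=1,\dots,n$, $$(\widetilde M[R](1)^{-1})^i_j=\frac1{|G|}\sum_{C\neq\{1\}}\frac{|C|\,(\chi_i(g_C)-d_i)\,(\overline{\chi_j(g_C)}-d_j)}{\det(E-R(g_C))}.$$ Moreover, the power series $M[R_S(q)]^i_j$ are Taylor expansions at $q=0$ of rational functions of $q$, denoted by the same symbols, and $$(\widetilde M[R](1)^{-1})^i_j=-\,d_id_j\,\operatorname{Res}_{q=1}\frac{M[R_S(q)]^0_0-\frac{M[R_S(q)]^i_0}{d_i}-\frac{M[R_S(q)]^0_j}{d_j}+\frac{M[R_S(q)]^i_j}{d_id_j}}{1-q}.$$ Finally, let $\theta_1,\dots,\theta_d$ be any homogeneous system of parameters, of degrees $n_1,\dots,n_d$, of the algebra of invariants $S(V)^G$, and for each $j$ let $\rho_{1j},\dots,\rho_{\mu_jj}$ be any homogeneous basis, of degrees $m_{1j},\dots,m_{\mu_jj}$, over $\mathbb C[\theta_1,\dots,\theta_d]$ of the module of covariants $\mathrm{Hom}_G(R_j,S(V))$. Put $D(R)=\prod_{k=1}^d\frac{1-q^{n_k}}{1-q}$,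 $D[R]^0_j=\sum_kq^{m_{kj}}$ and $D[R]^i_j=\sum_{k=0}^nM[R_i]^k_j\,D[R]^0_k$. Then $$(\widetilde M[R](1)^{-1})^i_j=-\,d_id_j\,\operatorname{Res}_{q=1}\frac{D[R]^0_0-\frac{D[R]^i_0}{d_i}-\frac{D[R]^0_j}{d_j}+\frac{D[R]^i_j}{d_id_j}}{(1-q)^{d+1}D(R)}.$$ Here $\operatorname{Res}_{q=1}$ is the usual residue, i.e. the coefficient of $(q-1)^{-1}$ in the Laurent expansion at $q=1$. -/

import Mathlib

open scoped TensorProduct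

noncomputable section

namespace ClebschGordan

/-! ### Symmetric and exterior powers of a representation -/

section Powers

variable {G V : Type*} [Group G] [AddCommGroup V] [Module ℂ V]

/-- The `m`-th exterior power `Λ^m R` of a representation `R`. -/
def extPower (R : Representation ℂ G V) (m : ℕ) : Representation ℂ G (⋀[ℂ]^m V) where
  toFun g := exteriorPower.map m (R g)
  map_one' := by
    rw [map_one]
    exact exteriorPower.map_id
  map_mul' g h := by
    rw [map_mul]
    exact exteriorPower.map_comp (R h) (R g)

/-- The action of `g` on the symmetric algebra `S(V)` by algebra endomorphisms. -/
def symAction (R : Representation ℂ G V) (g : G) :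
    SymmetricAlgebra ℂ V →ₐ[ℂ] SymmetricAlgebra ℂ V :=
  SymmetricAlgebra.lift (SymmetricAlgebra.ι ℂ V ∘ₗ R g)

theorem symAction_ι (R : Representation ℂ G V) (g : G) (v : V) :
    symAction R g (SymmetricAlgebra.ι ℂ V v) = SymmetricAlgebra.ι ℂ V (R g v) := by
  simp [symAction]

theorem symAction_one (R : Representation ℂ G V) : symAction R 1 = AlgHom.id ℂ _ := by
  apply SymmetricAlgebra.algHom_ext
  ext v
  simp [symAction_ι]

theorem symAction_mul (R : Representation ℂ G V) (g h : G) :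
    symAction R (g * h) = (symAction R g).comp (symAction R h) := by
  apply SymmetricAlgebra.algHom_ext
  ext v
  simp [symAction_ι]

/-- The degree `m` homogeneous component `S^m(V)` of the symmetric algebra: the span of all
products of `m` vectors. -/
def symDegree (V : Type*) [AddCommGroup V] [Module ℂ V] (m : ℕ) :
    Submodule ℂ (SymmetricAlgebra ℂ V) :=
  LinearMap.range (SymmetricAlgebra.ι ℂ V) ^ m

theorem symAction_mem_symDegree (R : Representation ℂ G V) (g : G) (m : ℕ)
    (x : SymmetricAlgebra ℂ V) (hx : x ∈ symDegree V m) : symAction R g x ∈ symDegree V m := by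
  have h1 : (LinearMap.range (SymmetricAlgebra.ι ℂ V)).map (symAction R g).toLinearMap ≤
      LinearMap.range (SymmetricAlgebra.ι ℂ V) := by
    rintro _ ⟨_, ⟨v, rfl⟩, rfl⟩
    exact ⟨R g v, (symAction_ι R g v).symm⟩
  have h2 : (symDegree V m).map (symAction R g).toLinearMap ≤ symDegree V m := by
    unfold symDegree
    rw [Submodule.map_pow]
    exact pow_le_pow_left' h1 m
  exact h2 ⟨x, hx, rfl⟩

/-- The `m`-th symmetric power `S^m R` of a representation `R`. -/
def symPower (R : Representation ℂ G V) (m : ℕ) : Representation ℂ G (symDegree V m) where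
  toFun g := (symAction R g).toLinearMap.restrict (symAction_mem_symDegree R g m)
  map_one' := by
    ext x
    simp [symAction_one, LinearMap.restrict_apply]
  map_mul' g h := by
    ext x
    change symAction R (g * h) x = symAction R g (symAction R h x)
    rw [symAction_mul]
    rfl

end Powers

/-! ### Irreducible representations and Clebsch-Gordan matrices -/

section Matrices

variable {G V : Type*} [Group G] [AddCommGroup V] [Module ℂ V] {n : ℕ}
  {W : Fin (n + 1) → Type*} [∀ i, AddCommGroup (W i)] [∀ i, Module ℂ (W i)]

/-- `ρ 0, …, ρ n` is a complete list, without repetition, of the irreducible complex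
representations of the finite group `G` up to isomorphism, and `ρ 0` is the trivial
one-dimensional representation. -/
structure IsIrrepList (ρ : ∀ i, Representation ℂ G (W i)) : Prop where
  irreducible : ∀ i, (ρ i).IsIrreducible
  injective : ∀ i j, Nonempty ((ρ i).Equiv (ρ j)) → i = j
  complete : ∀ (m : ℕ) (σ : Representation ℂ G (Fin m → ℂ)), σ.IsIrreducible →
    ∃ i, Nonempty (σ.Equiv (ρ i))
  trivial : Nonempty ((ρ 0).Equiv (Representation.trivial ℂ G ℂ))

/-- The Clebsch-Gordan matrix of a representation `Q`: the entry in row `i` and column `j` is the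
multiplicity of the irreducible representation `ρ j` in `Q ⊗ ρ i`. -/
def cgMatrix (ρ : ∀ i, Representation ℂ G (W i)) {U : Type*} [AddCommGroup U] [Module ℂ U]
    (Q : Representation ℂ G U) : Matrix (Fin (n + 1)) (Fin (n + 1)) ℕ :=
  Matrix.of fun i j => Module.finrank ℂ (Representation.IntertwiningMap (ρ j) (Q.tprod (ρ i)))

/-- The entries of the Clebsch-Gordan matrix of `∑ m, (S^m R) q^m`, as power series in `q`. -/
def cgSym (ρ : ∀ i, Representation ℂ G (W i)) (R : Representation ℂ G V) :
    Matrix (Fin (n + 1)) (Fin (n + 1)) (PowerSeries ℂ) :=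
  Matrix.of fun i j => PowerSeries.mk fun m => (cgMatrix ρ (symPower R m) i j : ℂ)

/-- The Clebsch-Gordan matrix of `∑ m, (Λ^m R) (-q)^m`, with entries polynomials in `q`
(the exterior powers vanish for `m > dim V`). -/
def cgExtNeg (ρ : ∀ i, Representation ℂ G (W i)) (R : Representation ℂ G V) :
    Matrix (Fin (n + 1)) (Fin (n + 1)) (Polynomial ℂ) :=
  Matrix.of fun i j => ∑ m ∈ Finset.range (Module.finrank ℂ V + 1),
    Polynomial.C (cgMatrix ρ (extPower R m) i j : ℂ) * (-Polynomial.X) ^ m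

/-- The Euclidean Clebsch-Gordan matrix: the row and the column of the trivial representation are
deleted. -/
def euclideanCG (ρ : ∀ i, Representation ℂ G (W i)) (R : Representation ℂ G V) :
    Matrix (Fin n) (Fin n) (Polynomial ℂ) :=
  (cgExtNeg ρ R).submatrix Fin.succ Fin.succ

/-- The Euclidean Cartan matrix: the Euclidean Clebsch-Gordan matrix at `q = 1`. -/
def euclideanCartan (ρ : ∀ i, Representation ℂ G (W i)) (R : Representation ℂ G V) :
    Matrix (Fin n) (Fin n) ℂ :=
  (euclideanCG ρ R).map (Polynomial.eval 1)

end Matrices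

/-! ### Modules of covariants and their Cohen-Macaulay numerators -/

section Covariants

variable {G V : Type*} [Group G] [AddCommGroup V] [Module ℂ V]

/-- The algebra of invariants `S(V)^G`. -/
def invariants (R : Representation ℂ G V) : Subalgebra ℂ (SymmetricAlgebra ℂ V) where
  carrier := {x | ∀ g, symAction R g x = x}
  mul_mem' hx hy g := by rw [map_mul, hx g, hy g]
  add_mem' hx hy g := by rw [map_add, hx g, hy g]
  algebraMap_mem' r g := (symAction R g).commutes r

/-- The module of covariants of type `σ`, that is, the `S(V)^G`-module of all `G`-equivariant
linear maps `U → S(V)`. Its degree `m` part consists of the equivariant maps `U → S^m(V)`. -/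
def covariants (R : Representation ℂ G V) {U : Type*} [AddCommGroup U] [Module ℂ U]
    (σ : Representation ℂ G U) :
    Submodule (invariants R) (U →ₗ[ℂ] SymmetricAlgebra ℂ V) where
  carrier := {f | ∀ g u, f (σ g u) = symAction R g (f u)}
  add_mem' hf hf' g u := by
    rw [LinearMap.add_apply, LinearMap.add_apply, hf g u, hf' g u, map_add]
  zero_mem' g u := by simp
  smul_mem' a f hf g u := by
    have ha : symAction R g (a : SymmetricAlgebra ℂ V) = a := a.2 g
    rw [LinearMap.smul_apply, LinearMap.smul_apply, Subalgebra.smul_def, Subalgebra.smul_def,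
      smul_eq_mul, smul_eq_mul, map_mul, ha, hf g u]

variable {n : ℕ} {W : Fin (n + 1) → Type*} [∀ i, AddCommGroup (W i)] [∀ i, Module ℂ (W i)]

/-- A homogeneous system of parameters `θ` (of degrees `degθ`) of the algebra of invariants
`S(V)^G`, together with a homogeneous basis `gen j` (of degrees `degGen j`) over `ℂ[θ]` of the
module of covariants of each type `ρ j`. -/
structure CMData (ρ : ∀ i, Representation ℂ G (W i)) (R : Representation ℂ G V) where
  θ : Fin (Module.finrank ℂ V) → invariants R
  degθ : Fin (Module.finrank ℂ V) → ℕ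
  degθ_pos : ∀ k, 0 < degθ k
  θ_mem : ∀ k, (θ k : SymmetricAlgebra ℂ V) ∈ symDegree V (degθ k)
  algebraicIndependent : AlgebraicIndependent ℂ θ
  finite : Module.Finite (Algebra.adjoin ℂ (Set.range θ)) (invariants R)
  μ : Fin (n + 1) → ℕ
  gen : ∀ j, Module.Basis (Fin (μ j)) (Algebra.adjoin ℂ (Set.range θ)) (covariants R (ρ j))
  degGen : ∀ j, Fin (μ j) → ℕ
  gen_mem : ∀ j k w, (gen j k : W j →ₗ[ℂ] SymmetricAlgebra ℂ V) w ∈ symDegree V (degGen j k)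

variable {ρ : ∀ i, Representation ℂ G (W i)} {R : Representation ℂ G V}

/-- The polynomial `D(R)` with `(1 - q)^d D(R) = ∏ k, (1 - q^(degθ k))`. -/
def CMData.denom (c : CMData ρ R) : Polynomial ℂ :=
  ∏ k, ∑ l ∈ Finset.range (c.degθ k), Polynomial.X ^ l

theorem CMData.denom_spec (c : CMData ρ R) :
    (1 - Polynomial.X) ^ Module.finrank ℂ V * c.denom =
      ∏ k, (1 - (Polynomial.X : Polynomial ℂ) ^ c.degθ k) := by
  have h : ∀ k, (1 - (Polynomial.X : Polynomial ℂ)) *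
      (∑ l ∈ Finset.range (c.degθ k), Polynomial.X ^ l) = 1 - Polynomial.X ^ c.degθ k :=
    fun k => mul_neg_geom_sum _ _
  simp only [← h, Finset.prod_mul_distrib, CMData.denom, Finset.prod_const, Finset.card_univ,
    Fintype.card_fin]

/-- The numerators `D[R]_j^0 = ∑ k, q^(degGen j k)`. -/
def CMData.numer₀ (c : CMData ρ R) (j : Fin (n + 1)) : Polynomial ℂ :=
  ∑ k, Polynomial.X ^ c.degGen j k

/-- The polynomials `D[R]_j^i = ∑ k, M[ρ i]_j^k D[R]_k^0`, in row `i` and column `j`. -/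
def CMData.numer (c : CMData ρ R) : Matrix (Fin (n + 1)) (Fin (n + 1)) (Polynomial ℂ) :=
  Matrix.of fun i j => ∑ k, Polynomial.C (cgMatrix ρ (ρ i) k j : ℂ) * c.numer₀ k

end Covariants

/-! ### Rational functions -/

/-- The residue of a rational function at the point `a`: the coefficient of `(q - a)⁻¹` in its
Laurent expansion in powers of `q - a`. -/
def residue (a : ℂ) (f : RatFunc ℂ) : ℂ :=
  ((RatFunc.laurent a f : RatFunc ℂ) : LaurentSeries ℂ).coeff (-1)

/-- The rational function `f` is regular at `0` and `s` is its Taylor series there. -/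
def IsExpansion (f : RatFunc ℂ) (s : PowerSeries ℂ) : Prop :=
  (f : LaurentSeries ℂ) = (s : LaurentSeries ℂ)

end ClebschGordan

end

/-!
The multiplicity of `ρ j` in `Q ⊗ ρ i` is the average over `G` of `χ_Q(g) χ_i(g) χ_j(g⁻¹)`, so in
the coordinates given by the irreducible characters a Clebsch-Gordan matrix acts on class functions
as multiplication by `χ_Q`. The eigenvalues of `R g` give `∑ tr (Λ^m g) (-q)^m = det (1 - q g)` and
Molien's identity `∑ tr (S^m g) q^m = 1 / det (1 - q g)`; the matrices of `Λ` and `S` are therefore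
the averages of `χ_i(g) χ_j(g⁻¹)` weighted by `det (1 - q g)` and by its inverse.

Let `G` be nontrivial, so that `V ≠ 0`. At `q = 1` the weight `det (1 - g)` vanishes at `g = 1`
only, as the action is free. Deleting the trivial representation makes multiplication by this weight
invertible: by completeness of the irreducible characters (`IsIrrepList.expansion`) and the
vanishing of the regular character away from the identity, `|G|⁻¹` times the sum over `g ≠ 1` of
`(χ_i(g) - d_i) (χ_j(g⁻¹) - d_j) / det (1 - g)` is a right inverse
(`euclideanCartan_mul_cartanInverse`). Since `χ(g⁻¹)` is the complex conjugate of `χ(g)`, arranging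
this sum by conjugacy classes gives the product of three matrices.

For the residues (`residue_cgRat`), the combination of the entries of the matrix of `S` is the
average of `(1 - χ_i(g) / d_i) (1 - χ_j(g⁻¹) / d_j) / det (1 - q g)`. Its term at the identity is
zero, the others are regular at `q = 1`, and dividing by `1 - q` produces a simple pole whose
residue is minus the value at `q = 1`. Finally, the monomials in the parameters times the module
generators form a homogeneous basis of each module of covariants. Counting them by degree
identifies the Molien series with the quotients `D[R] / ((1 - q)^d D(R))` (`CMData.cgRat_eq`).
-/

noncomputable section

namespace ClebschGordan

/-! ### Operators of finite order -/

section Diagonalization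

variable {V : Type*} [AddCommGroup V] [Module ℂ V] [FiniteDimensional ℂ V]

theorem exists_eigenbasis_of_pow_eq_one (f : Module.End ℂ V) {N : ℕ} (hN : N ≠ 0)
    (hf : f ^ N = 1) :
    ∃ (b : Module.Basis (Fin (Module.finrank ℂ V)) ℂ V) (l : Fin (Module.finrank ℂ V) → ℂ),
      (∀ i, f (b i) = l i • b i) ∧ ∀ i, l i ^ N = 1 := by
  classical
  have hss : f.IsSemisimple := by
    refine Module.End.isSemisimple_of_squarefree_aeval_eq_zero (p := Polynomial.X ^ N - 1) ?_ ?_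
    · exact (Polynomial.separable_X_pow_sub_C (1 : ℂ) (by exact_mod_cast hN)
        one_ne_zero).squarefree
    · simp [hf]
  have hint : DirectSum.IsInternal f.eigenspace :=
    DirectSum.isInternal_submodule_of_iSupIndep_of_iSup_eq_top f.eigenspaces_iSupIndep
      hss.iSup_eigenspace_eq_top
  let b₀ := hint.collectedBasis fun μ => Module.finBasis ℂ (f.eigenspace μ)
  have hb₀ : ∀ a, f (b₀ a) = a.1 • b₀ a := fun a =>
    Module.End.mem_eigenspace_iff.mp (hint.collectedBasis_mem _ a)
  have : Finite (Σ μ, Fin (Module.finrank ℂ (f.eigenspace μ))) := Module.Finite.finite_basis b₀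
  let _ := Fintype.ofFinite (Σ μ, Fin (Module.finrank ℂ (f.eigenspace μ)))
  let e := Fintype.equivFinOfCardEq (Module.finrank_eq_card_basis b₀).symm
  have hb : ∀ i, f (b₀.reindex e i) = (e.symm i).1 • b₀.reindex e i := fun i => by
    simp [hb₀]
  refine ⟨b₀.reindex e, fun i => (e.symm i).1, hb, fun i => ?_⟩
  have hpow : ∀ m : ℕ, (f ^ m) (b₀.reindex e i) = (e.symm i).1 ^ m • b₀.reindex e i := by
    intro m
    induction m with
    | zero => simp
    | succ m ih => rw [pow_succ', Module.End.mul_apply, ih, map_smul, hb, smul_smul, pow_succ]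
  have h1 := hpow N
  rw [hf, Module.End.one_apply] at h1
  have h2 : ((e.symm i).1 ^ N - 1) • b₀.reindex e i = 0 := by
    rw [sub_smul, ← h1, one_smul, sub_self]
  exact sub_eq_zero.mp ((smul_eq_zero.mp h2).resolve_right ((b₀.reindex e).ne_zero i))

omit [FiniteDimensional ℂ V] in
theorem trace_eq_sum_of_eigenbasis {ι : Type*} [Fintype ι] (b : Module.Basis ι ℂ V)
    (f : Module.End ℂ V) (l : ι → ℂ) (h : ∀ i, f (b i) = l i • b i) :
    LinearMap.trace ℂ V f = ∑ i, l i := by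
  classical
  rw [LinearMap.trace_eq_matrix_trace ℂ b, Matrix.trace]
  exact Finset.sum_congr rfl fun i _ => by simp [LinearMap.toMatrix_apply, h]

omit [FiniteDimensional ℂ V] in
theorem det_eq_prod_of_eigenbasis {ι : Type*} [Fintype ι] (b : Module.Basis ι ℂ V)
    (f : Module.End ℂ V) (l : ι → ℂ) (h : ∀ i, f (b i) = l i • b i) :
    LinearMap.det f = ∏ i, l i := by
  classical
  rw [← LinearMap.det_toMatrix b]
  have : LinearMap.toMatrix b b f = Matrix.diagonal l := by
    ext i j
    by_cases hij : i = j
    · subst hij; simp [LinearMap.toMatrix_apply, h]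
    · simp [LinearMap.toMatrix_apply, h, Matrix.diagonal_apply_ne _ hij, Ne.symm hij]
  rw [this, Matrix.det_diagonal]

end Diagonalization

section Eigenbasis

variable {G : Type*} [Group G] [Finite G]
  {V : Type*} [AddCommGroup V] [Module ℂ V] [FiniteDimensional ℂ V]

theorem exists_eigenbasis (σ : Representation ℂ G V) (g : G) :
    ∃ (b : Module.Basis (Fin (Module.finrank ℂ V)) ℂ V) (l : Fin (Module.finrank ℂ V) → ℂ),
      (∀ i, σ g (b i) = l i • b i) ∧ ∀ i, l i ^ Nat.card G = 1 :=
  exists_eigenbasis_of_pow_eq_one (σ g) Nat.card_pos.ne'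
    (by rw [← map_pow, pow_card_eq_one', map_one])

/-- The eigenvalues are roots of unity, whose inverses are their conjugates. -/
theorem character_inv (σ : Representation ℂ G V) (g : G) :
    σ.character g⁻¹ = (starRingEnd ℂ) (σ.character g) := by
  obtain ⟨b, l, hb, hl⟩ := exists_eigenbasis σ g
  have hinv : ∀ i, σ g⁻¹ (b i) = (l i)⁻¹ • b i := by
    intro i
    have hl0 : l i ≠ 0 := by
      intro h0
      simpa [h0, Nat.card_pos.ne'] using hl i
    have h1 : σ g⁻¹ (σ g (b i)) = b i := by
      rw [← Module.End.mul_apply, ← map_mul, inv_mul_cancel, map_one, Module.End.one_apply]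
    rw [hb, map_smul] at h1
    rw [eq_inv_smul_iff₀ hl0, h1]
  rw [Representation.character, Representation.character, trace_eq_sum_of_eigenbasis b _ _ hb,
    trace_eq_sum_of_eigenbasis b _ _ hinv, map_sum]
  refine Finset.sum_congr rfl fun i _ => Complex.inv_eq_conj ?_
  exact Complex.norm_eq_one_of_pow_eq_one (hl i) Nat.card_pos.ne'

end Eigenbasis

/-! ### Completeness of the irreducible characters -/

section Completeness

variable {G : Type*} [Group G]

theorem isIrreducible_of_equiv {V V' : Type*} [AddCommGroup V] [Module ℂ V] [AddCommGroup V']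
    [Module ℂ V'] {σ : Representation ℂ G V} {τ : Representation ℂ G V'} (e : σ.Equiv τ)
    (h : σ.IsIrreducible) : τ.IsIrreducible := by
  rw [Representation.irreducible_iff_isSimpleModule_asModule] at h ⊢
  have hb : Function.Bijective
      (Representation.IntertwiningMap.equivLinearMapAsModule τ σ e.symm.toIntertwiningMap) :=
    e.symm.toLinearEquiv.bijective
  exact IsSimpleModule.congr (LinearEquiv.ofBijective _ hb)

variable [Fintype G]

/-- The operator by which the element `∑ g, ψ g • g` of the group algebra acts in a
representation. -/
def groupSum {V : Type*} [AddCommGroup V] [Module ℂ V] (σ : Representation ℂ G V) (ψ : G → ℂ) :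
    Module.End ℂ V :=
  ∑ g, ψ g • σ g

theorem trace_groupSum {V : Type*} [AddCommGroup V] [Module ℂ V] (σ : Representation ℂ G V)
    (ψ : G → ℂ) : LinearMap.trace ℂ V (groupSum σ ψ) = ∑ g, ψ g * σ.character g := by
  simp [groupSum, Representation.character]

theorem groupSum_comm {V : Type*} [AddCommGroup V] [Module ℂ V] (σ : Representation ℂ G V)
    {ψ : G → ℂ} (hψ : ∀ g h, ψ (h * g * h⁻¹) = ψ g) (h : G) :
    groupSum σ ψ ∘ₗ σ h = σ h ∘ₗ groupSum σ ψ := by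
  change groupSum σ ψ * σ h = σ h * groupSum σ ψ
  rw [groupSum, Finset.sum_mul, Finset.mul_sum]
  refine Fintype.sum_equiv (MulAut.conj h⁻¹).toEquiv _ _ fun g => ?_
  have h1 : ψ ((MulAut.conj h⁻¹) g) = ψ g := by
    rw [MulAut.conj_apply, hψ]
  change _ = σ h * ψ ((MulAut.conj h⁻¹) g) • σ ((MulAut.conj h⁻¹) g)
  rw [h1, mul_smul_comm, smul_mul_assoc, ← map_mul, ← map_mul, MulAut.conj_apply]
  congr 2
  group

/-- By Schur's lemma a class function acts in an irreducible representation by a scalar, which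
vanishes as soon as the trace does. -/
theorem groupSum_eq_zero_of_isIrreducible {V : Type*} [AddCommGroup V] [Module ℂ V]
    [FiniteDimensional ℂ V] (σ : Representation ℂ G V) (hσ : σ.IsIrreducible)
    {ψ : G → ℂ} (hψ : ∀ g h, ψ (h * g * h⁻¹) = ψ g) (h0 : ∑ g, ψ g * σ.character g = 0) :
    groupSum σ ψ = 0 := by
  let f : Representation.IntertwiningMap σ σ := ⟨groupSum σ ψ, fun h => groupSum_comm σ hψ h⟩
  obtain ⟨c, hc⟩ :=
    Representation.IsIrreducible.algebraMap_intertwiningMap_bijective_of_isAlgClosed.2 f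
  have hc' : groupSum σ ψ = c • (1 : Module.End ℂ V) := by
    ext v
    have := congrArg (fun F : Representation.IntertwiningMap σ σ => F v) hc
    simpa [f] using this.symm
  rw [← trace_groupSum, hc', map_smul, LinearMap.trace_one, smul_eq_mul] at h0
  have hd : (Module.finrank ℂ V : ℂ) ≠ 0 := by
    rw [Nat.cast_ne_zero]
    have : Nontrivial V := by
      have := (Representation.irreducible_iff_isSimpleModule_asModule σ).mp hσ
      exact IsSimpleModule.nontrivial (MonoidAlgebra ℂ G) σ.asModule
    exact Module.finrank_pos.ne'
  rw [hc', (mul_eq_zero.mp h0).resolve_right hd, zero_smul]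

/-- Maschke's theorem reduces the vanishing of the action of a class function to irreducible
representations. -/
theorem groupSum_eq_zero {ψ : G → ℂ}
    (hirr : ∀ (m : ℕ) (σ : Representation ℂ G (Fin m → ℂ)), σ.IsIrreducible → groupSum σ ψ = 0)
    {V : Type*} [AddCommGroup V] [Module ℂ V] [FiniteDimensional ℂ V]
    (σ : Representation ℂ G V) : groupSum σ ψ = 0 := by
  induction hd : Module.finrank ℂ V using Nat.strong_induction_on generalizing V with
  | _ d ih =>
  by_cases hσ : σ.IsIrreducible
  · let e := (Module.finBasis ℂ V).equivFun
    let τ : Representation ℂ G (Fin (Module.finrank ℂ V) → ℂ) :=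
      { toFun := fun g => e.conj (σ g)
        map_one' := by simp [Module.End.one_eq_id]
        map_mul' := fun g h => by rw [map_mul]; exact LinearEquiv.conj_comp e _ _ }
    have he : σ.Equiv τ := Representation.Equiv.mk e fun g => by
      ext v; simp [τ]
    have h1 := hirr _ τ (isIrreducible_of_equiv he hσ)
    have h2 : groupSum τ ψ = e.conj (groupSum σ ψ) := by
      simp [groupSum, τ]
    rw [h2] at h1
    exact (LinearEquiv.map_eq_zero_iff _).mp h1
  rcases subsingleton_or_nontrivial V with hV | hV
  · exact Subsingleton.elim _ _
  -- a reducible representation is the sum of a proper subrepresentation and a complement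
  obtain ⟨p, hp0, hp1⟩ : ∃ p : Subrepresentation σ, p ≠ ⊥ ∧ p ≠ ⊤ := by
    by_contra! hcon
    have hne : (⊥ : Subrepresentation σ) ≠ ⊤ := fun h =>
      (bot_ne_top : (⊥ : Submodule ℂ V) ≠ ⊤) (congrArg Subrepresentation.toSubmodule h)
    refine hσ { exists_pair_ne := ⟨⊥, ⊤, hne⟩, eq_bot_or_eq_top := fun p => ?_ }
    by_cases hp : p = ⊥
    · exact Or.inl hp
    · exact Or.inr (hcon p hp)
  have : NeZero (Nat.card G : ℂ) := ⟨by simp [Nat.card_eq_fintype_card]⟩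
  obtain ⟨q, hpq⟩ := exists_isCompl p
  have hsup : p.toSubmodule ⊔ q.toSubmodule = ⊤ :=
    congrArg Subrepresentation.toSubmodule hpq.sup_eq_top
  have hq1 : q ≠ ⊤ := by
    rintro rfl
    exact hp0 (by simpa using hpq.inf_eq_bot)
  have hker : ∀ r : Subrepresentation σ, r ≠ ⊤ →
      r.toSubmodule ≤ LinearMap.ker (groupSum σ ψ) := by
    intro r hr x hx
    have hlt : Module.finrank ℂ r.toSubmodule < d := by
      rw [← hd]
      exact Submodule.finrank_lt fun h => hr (Subrepresentation.toSubmodule_injective h)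
    have h1 := congrArg Subtype.val
      (LinearMap.congr_fun (ih _ hlt r.toRepresentation rfl) ⟨x, hx⟩)
    simpa [groupSum, Subrepresentation.toRepresentation] using h1
  rw [← LinearMap.ker_eq_top, eq_top_iff, ← hsup]
  exact sup_le (hker p hp1) (hker q hq1)

/-- A class function whose group algebra element acts as zero in every finite-dimensional
representation vanishes, by faithfulness of the regular representation. -/
theorem eq_zero_of_groupSum_eq_zero {ψ : G → ℂ}
    (h : ∀ σ : Representation ℂ G (G → ℂ), groupSum σ ψ = 0) : ψ = 0 := by
  classical
  let σ : Representation ℂ G (G → ℂ) :=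
    { toFun := fun g => LinearMap.funLeft ℂ ℂ fun x => g⁻¹ * x
      map_one' := by ext; simp
      map_mul' := fun g g' => by
        refine LinearMap.ext fun f => funext fun x => ?_
        simp [LinearMap.funLeft_apply, mul_assoc] }
  have h1 := LinearMap.congr_fun (h σ) (Pi.single 1 1)
  ext x
  have h2 := congrFun h1 x
  simpa [groupSum, σ, LinearMap.funLeft_apply, Pi.single_apply, inv_mul_eq_one] using h2

variable {n : ℕ} {W : Fin (n + 1) → Type*} [∀ i, AddCommGroup (W i)] [∀ i, Module ℂ (W i)]
  [∀ i, FiniteDimensional ℂ (W i)] {ρ : ∀ i, Representation ℂ G (W i)}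

theorem IsIrrepList.sum_character_mul_character_inv (hρ : IsIrrepList ρ) (i j : Fin (n + 1)) :
    (Nat.card G : ℂ)⁻¹ * ∑ g, (ρ i).character g * (ρ j).character g⁻¹ = if i = j then 1 else 0 := by
  have := hρ.irreducible i
  have := hρ.irreducible j
  let _ : Invertible (Nat.card G : ℂ) := invertibleOfNonzero (by simp [Nat.card_eq_fintype_card])
  rw [Representation.char_orthonormal]
  by_cases hij : i = j
  · subst hij
    rw [if_pos rfl, if_pos ⟨Representation.Equiv.refl _⟩]
  · rw [if_neg hij, if_neg fun h => hij (hρ.injective j i h).symm]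

omit [Fintype G] [∀ i, FiniteDimensional ℂ (W i)] in
theorem IsIrrepList.character_zero (hρ : IsIrrepList ρ) (g : G) : (ρ 0).character g = 1 := by
  obtain ⟨e⟩ := hρ.trivial
  rw [Representation.char_iso e]
  simp [Representation.character]

omit [Fintype G] in
theorem IsIrrepList.finrank_ne_zero (hρ : IsIrrepList ρ) (i : Fin (n + 1)) :
    (Module.finrank ℂ (W i) : ℂ) ≠ 0 := by
  rw [Nat.cast_ne_zero]
  have := (Representation.irreducible_iff_isSimpleModule_asModule (ρ i)).mp (hρ.irreducible i)
  have : Nontrivial (W i) := IsSimpleModule.nontrivial (MonoidAlgebra ℂ G) (ρ i).asModule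
  exact Module.finrank_pos.ne'

omit [∀ i, FiniteDimensional ℂ (W i)] in
/-- A class function orthogonal to all irreducible characters vanishes. -/
theorem IsIrrepList.eq_zero_of_orthogonal (hρ : IsIrrepList ρ) {ψ : G → ℂ}
    (hψ : ∀ g h, ψ (h * g * h⁻¹) = ψ g)
    (horth : ∀ j, ∑ g, ψ g * (ρ j).character g = 0) : ψ = 0 := by
  refine eq_zero_of_groupSum_eq_zero fun σ => groupSum_eq_zero (fun m τ hτ => ?_) σ
  obtain ⟨j, ⟨e⟩⟩ := hρ.complete m τ hτ
  refine groupSum_eq_zero_of_isIrreducible τ hτ hψ ?_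
  rw [Representation.char_iso e]
  exact horth j

/-- The irreducible characters span the class functions. -/
theorem IsIrrepList.expansion (hρ : IsIrrepList ρ) {f : G → ℂ}
    (hf : ∀ g h, f (h * g * h⁻¹) = f g) (x : G) :
    f x = ∑ j, ((Nat.card G : ℂ)⁻¹ * ∑ g, f g * (ρ j).character g⁻¹) * (ρ j).character x := by
  -- the defect of the expansion, composed with inversion, is orthogonal to every character
  set c : Fin (n + 1) → ℂ := fun j => (Nat.card G : ℂ)⁻¹ * ∑ g, f g * (ρ j).character g⁻¹ with hc
  have hN : (Nat.card G : ℂ) ≠ 0 := by simp [Nat.card_eq_fintype_card]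
  have key : (fun g => f g⁻¹ - ∑ j, c j * (ρ j).character g⁻¹) = 0 := by
    refine hρ.eq_zero_of_orthogonal (fun g h => ?_) fun k => ?_
    · have hconj : (h * g * h⁻¹)⁻¹ = h * g⁻¹ * h⁻¹ := by group
      simp only [hconj, hf, Representation.char_conj]
    · have h1 : ∑ g, f g⁻¹ * (ρ k).character g = Nat.card G * c k := by
        rw [hc, mul_inv_cancel_left₀ hN]
        exact Fintype.sum_equiv (Equiv.inv G) _ _ fun g => by simp
      have h2 : ∀ j, ∑ g, (ρ j).character g⁻¹ * (ρ k).character g =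
          Nat.card G * if k = j then 1 else 0 := by
        intro j
        rw [← hρ.sum_character_mul_character_inv k j, mul_inv_cancel_left₀ hN]
        exact Finset.sum_congr rfl fun g _ => mul_comm _ _
      simp only [sub_mul, Finset.sum_sub_distrib, h1, Finset.sum_mul, mul_assoc]
      rw [Finset.sum_comm]
      simp only [← Finset.mul_sum, h2]
      simp [mul_comm]
  have := congrFun key x⁻¹
  simp only [inv_inv, Pi.zero_apply] at this
  exact sub_eq_zero.mp this

/-- The column of the identity: the regular character vanishes away from the identity. -/
theorem IsIrrepList.sum_finrank_mul_character (hρ : IsIrrepList ρ) {g : G} (hg : g ≠ 1) :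
    ∑ j, (Module.finrank ℂ (W j) : ℂ) * (ρ j).character g = 0 := by
  classical
  have hN : (Nat.card G : ℂ) ≠ 0 := by simp [Nat.card_eq_fintype_card]
  have h := hρ.expansion (f := fun x => if x = 1 then 1 else 0) (fun x y => by
    simp [mul_assoc, mul_eq_one_iff_eq_inv']) g
  simp only [hg, if_false, ite_mul, one_mul, zero_mul, Finset.sum_ite_eq', Finset.mem_univ, if_true,
    inv_one, Representation.char_one, mul_assoc, ← Finset.mul_sum] at h
  exact (mul_eq_zero.mp h.symm).resolve_left (inv_ne_zero hN)

/-! ### Clebsch-Gordan matrices through characters -/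

variable {U : Type*} [AddCommGroup U] [Module ℂ U] [FiniteDimensional ℂ U]

theorem cgMatrix_eq_sum (ρ : ∀ i, Representation ℂ G (W i)) (Q : Representation ℂ G U)
    (i j : Fin (n + 1)) :
    (cgMatrix ρ Q i j : ℂ) = (Nat.card G : ℂ)⁻¹ *
      ∑ g, Q.character g * ((ρ i).character g * (ρ j).character g⁻¹) := by
  let _ : Invertible (Nat.card G : ℂ) := invertibleOfNonzero (by simp [Nat.card_eq_fintype_card])
  rw [cgMatrix, Matrix.of_apply, ← Representation.card_inv_mul_sum_char_mul_char_eq_finrank]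
  simp [mul_assoc]

/-- Associativity of the tensor product: `Q ⊗ ρ i` decomposes along the decomposition of `Q`. -/
theorem IsIrrepList.cgMatrix_eq_sum_mul (hρ : IsIrrepList ρ) (Q : Representation ℂ G U)
    (i j : Fin (n + 1)) :
    (cgMatrix ρ Q i j : ℂ) = ∑ k, (cgMatrix ρ (ρ i) k j : ℂ) * cgMatrix ρ Q 0 k := by
  have hQ := fun g => hρ.expansion (f := Q.character) (fun x y => Q.char_conj x y) g
  simp only [cgMatrix_eq_sum, hρ.character_zero, one_mul]
  simp_rw [mul_assoc, ← Finset.mul_sum, Finset.sum_mul]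
  rw [Finset.sum_comm]
  congr 1
  refine Finset.sum_congr rfl fun g _ => ?_
  conv_lhs => rw [hQ g, Finset.sum_mul]
  refine Finset.sum_congr rfl fun k _ => ?_
  ring

theorem finrank_intertwiningMap_eq_cgMatrix (hρ : IsIrrepList ρ) (Q : Representation ℂ G U)
    (j : Fin (n + 1)) :
    Module.finrank ℂ (Representation.IntertwiningMap (ρ j) Q) = cgMatrix ρ Q 0 j := by
  let _ : Invertible (Nat.card G : ℂ) := invertibleOfNonzero (by simp [Nat.card_eq_fintype_card])
  rw [← Nat.cast_inj (R := ℂ), cgMatrix_eq_sum,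
    ← Representation.card_inv_mul_sum_char_mul_char_eq_finrank]
  simp [hρ.character_zero]

/-- A sum of a class function over the group, arranged by conjugacy classes. -/
theorem sum_eq_sum_conjClasses [Fintype (ConjClasses G)] {f : G → ℂ}
    (hf : ∀ g h, f (h * g * h⁻¹) = f g) {rep : ConjClasses G → G}
    (hrep : ∀ C, ConjClasses.mk (rep C) = C) :
    ∑ g, f g = ∑ C, (Nat.card (ConjClasses.carrier C) : ℂ) * f (rep C) := by
  classical
  rw [← Finset.sum_fiberwise (s := Finset.univ) (g := ConjClasses.mk)]
  refine Finset.sum_congr rfl fun C _ => ?_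
  have h1 : ∀ g ∈ Finset.univ.filter fun g => ConjClasses.mk g = C, f g = f (rep C) := by
    intro g hg
    have h2 : ConjClasses.mk g = ConjClasses.mk (rep C) := by
      rw [hrep]; exact (Finset.mem_filter.mp hg).2
    obtain ⟨c, hc⟩ := isConj_iff.mp (ConjClasses.mk_eq_mk_iff_isConj.mp h2)
    rw [← hc, hf]
  rw [Finset.sum_congr rfl h1, Finset.sum_const, nsmul_eq_mul]
  congr 2
  rw [Nat.card_eq_fintype_card, Fintype.card_of_finset' _ fun g => ?_]
  simp [ConjClasses.mem_carrier_iff_mk_eq]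

end Completeness

/-! ### Generating functions of exponent vectors -/

section GeneratingFunctions

variable {ι : Type*} [Fintype ι] [DecidableEq ι]

/-- The geometric series in several variables: the products `∏ i, a i ^ (β i / w i)` over all
vectors `β` of weight `m` with `w i ∣ β i` have generating function `∏ i, (1 - a i q ^ w i)⁻¹`. -/
theorem mk_sum_finsuppAntidiag_mul_prod (a : ι → ℂ) (w : ι → ℕ) (hw : ∀ i, 0 < w i) :
    PowerSeries.mk (fun m => ∑ β ∈ Finset.univ.finsuppAntidiag m,
      ∏ i, if w i ∣ β i then a i ^ (β i / w i) else 0) *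
      ∏ i, (1 - PowerSeries.C (a i) * PowerSeries.X ^ w i) = 1 := by
  have h1 : PowerSeries.mk (fun m => ∑ β ∈ Finset.univ.finsuppAntidiag m,
      ∏ i, if w i ∣ β i then a i ^ (β i / w i) else 0) =
      ∏ i, PowerSeries.mk fun m => if w i ∣ m then a i ^ (m / w i) else 0 := by
    ext m
    simp [PowerSeries.coeff_prod]
  rw [h1, ← Finset.prod_mul_distrib]
  refine Finset.prod_eq_one fun i _ => ?_
  ext m
  rw [mul_sub, mul_one, map_sub, PowerSeries.coeff_mk, mul_comm (PowerSeries.C (a i)), ← mul_assoc,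
    PowerSeries.coeff_mul_C, PowerSeries.coeff_mul_X_pow', PowerSeries.coeff_mk,
    PowerSeries.coeff_one]
  by_cases hm : w i ≤ m
  · have hm0 : m ≠ 0 := by have := hw i; omega
    obtain ⟨k, rfl⟩ := Nat.exists_eq_add_of_le hm
    simp only [hm, if_true, add_tsub_cancel_left, hm0, if_false, Nat.dvd_add_self_left]
    by_cases hd : w i ∣ k
    · simp [hd, Nat.add_div_left _ (hw i), pow_succ]
    · simp [hd]
  · have hdvd : w i ∣ m ↔ m = 0 :=
      ⟨fun h => Nat.eq_zero_of_dvd_of_lt h (by omega), by rintro rfl; simp⟩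
    by_cases hm0 : m = 0
    · subst hm0; simp [(hw i).ne']
    · simp [hm, hdvd, hm0]

end GeneratingFunctions

/-! ### Traces on exterior and symmetric powers -/

section Traces

variable {G V : Type*} [Group G] [AddCommGroup V] [Module ℂ V]

theorem map_symDegree_equivMvPolynomial {ι : Type*} (b : Module.Basis ι ℂ V) (m : ℕ) :
    (symDegree V m).map (SymmetricAlgebra.equivMvPolynomial b).toAlgHom.toLinearMap =
      MvPolynomial.homogeneousSubmodule ι ℂ m := by
  rw [symDegree, Submodule.map_pow, ← MvPolynomial.homogeneousSubmodule_one_pow,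
    MvPolynomial.homogeneousSubmodule_one_eq_span_X]
  congr 1
  rw [← LinearMap.range_comp, LinearMap.range_eq_map, ← b.span_eq, Submodule.map_span,
    ← Set.range_comp]
  congr 2
  ext i
  simp

/-- The isomorphism of the degree `m` part of the symmetric algebra with the homogeneous
polynomials of degree `m` in the elements of a basis. -/
def symDegreeEquiv {ι : Type*} (b : Module.Basis ι ℂ V) (m : ℕ) :
    symDegree V m ≃ₗ[ℂ] MvPolynomial.homogeneousSubmodule ι ℂ m :=
  ((SymmetricAlgebra.equivMvPolynomial b).toLinearEquiv.submoduleMap (symDegree V m)).trans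
    (LinearEquiv.ofEq _ _ (map_symDegree_equivMvPolynomial b m))

theorem symDegreeEquiv_apply {ι : Type*} (b : Module.Basis ι ℂ V) (m : ℕ) (x : symDegree V m) :
    (symDegreeEquiv b m x : MvPolynomial ι ℂ) = SymmetricAlgebra.equivMvPolynomial b x := rfl

instance [FiniteDimensional ℂ V] (m : ℕ) : FiniteDimensional ℂ (symDegree V m) := by
  have : Module.Finite ℂ (MvPolynomial.homogeneousSubmodule
      (Fin (Module.finrank ℂ V)) ℂ m) :=
    Module.Finite.iff_fg.mpr (MvPolynomial.homogeneousSubmodule_fg _ _ m)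
  exact Module.Finite.equiv (symDegreeEquiv (Module.finBasis ℂ V) m).symm

/-- The monomial basis of the homogeneous polynomials of degree `m`. -/
def homogeneousBasis (ι : Type*) [Fintype ι] [DecidableEq ι] (m : ℕ) :
    Module.Basis ((Finset.univ : Finset ι).finsuppAntidiag m) ℂ
      (MvPolynomial.homogeneousSubmodule ι ℂ m) :=
  Module.Basis.mk
    (v := fun α => ⟨MvPolynomial.monomial α.1 1, MvPolynomial.isHomogeneous_monomial 1 (by
      have h := (Finset.mem_finsuppAntidiag.mp α.2).1
      exact (Finsupp.degree_eq_sum _).trans h)⟩)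
    (by
      refine LinearIndependent.of_comp (Submodule.subtype _) ?_
      exact (MvPolynomial.basisMonomials ι ℂ).linearIndependent.comp
        (fun α : (Finset.univ : Finset ι).finsuppAntidiag m => α.1) Subtype.val_injective)
    (by
      rw [← Submodule.map_le_map_iff_of_injective (Submodule.subtype_injective _),
        Submodule.map_span, Submodule.map_top, Submodule.range_subtype, ← Set.range_comp]
      intro p hp
      rw [p.as_sum]
      refine Submodule.sum_mem _ fun α hα => ?_
      rw [← mul_one (p.coeff α), ← smul_eq_mul, ← MvPolynomial.smul_monomial]
      refine Submodule.smul_mem _ _ (Submodule.subset_span ⟨⟨α, ?_⟩, rfl⟩)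
      rw [Finset.mem_finsuppAntidiag]
      refine ⟨?_, Finset.subset_univ _⟩
      rw [← Finsupp.degree_eq_sum]
      by_contra h
      exact MvPolynomial.mem_support_iff.mp hα
        (((MvPolynomial.mem_homogeneousSubmodule _ _).mp hp).coeff_eq_zero h))

theorem coe_homogeneousBasis {ι : Type*} [Fintype ι] [DecidableEq ι] (m : ℕ)
    (α : (Finset.univ : Finset ι).finsuppAntidiag m) :
    (homogeneousBasis ι m α : MvPolynomial ι ℂ) = MvPolynomial.monomial α.1 1 := by
  simp [homogeneousBasis]

theorem trace_symPower (R : Representation ℂ G V) (g : G) {ι : Type*} [Fintype ι] [DecidableEq ι]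
    (b : Module.Basis ι ℂ V) (l : ι → ℂ) (h : ∀ i, R g (b i) = l i • b i) (m : ℕ) :
    (symPower R m).character g = ∑ β ∈ Finset.univ.finsuppAntidiag m, ∏ i, l i ^ β i := by
  rw [Representation.character, trace_eq_sum_of_eigenbasis
    ((homogeneousBasis ι m).map (symDegreeEquiv b m).symm) _ fun α => ∏ i, l i ^ α.1 i]
  · exact Finset.sum_coe_sort _ fun β : ι →₀ ℕ => ∏ i, l i ^ β i
  · intro α
    -- `g` scales the variables by its eigenvalues
    have hconj : ∀ x : SymmetricAlgebra ℂ V,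
        SymmetricAlgebra.equivMvPolynomial b (symAction R g x) =
          MvPolynomial.aeval (fun i => MvPolynomial.C (l i) * MvPolynomial.X i)
          (SymmetricAlgebra.equivMvPolynomial b x) := by
      intro x
      refine AlgHom.congr_fun (φ₁ := ((SymmetricAlgebra.equivMvPolynomial b).toAlgHom.comp
        (symAction R g))) (φ₂ := (MvPolynomial.aeval _).comp
          (SymmetricAlgebra.equivMvPolynomial b).toAlgHom) ?_ x
      refine SymmetricAlgebra.algHom_ext (b.ext fun i => ?_)
      simp [symAction_ι, h, MvPolynomial.smul_eq_C_mul]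
    apply (symDegreeEquiv b m).injective
    apply Subtype.ext
    have h1 : (symDegreeEquiv b m (symPower R m g
        ((homogeneousBasis ι m).map (symDegreeEquiv b m).symm α)) : MvPolynomial ι ℂ) =
        SymmetricAlgebra.equivMvPolynomial b (symAction R g
          ((homogeneousBasis ι m).map (symDegreeEquiv b m).symm α : symDegree V m)) := rfl
    rw [h1, hconj, map_smul, Submodule.coe_smul, ← symDegreeEquiv_apply, Module.Basis.map_apply,
      LinearEquiv.apply_symm_apply, coe_homogeneousBasis, MvPolynomial.aeval_monomial,
      MvPolynomial.monomial_eq, MvPolynomial.smul_eq_C_mul]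
    simp only [map_one, one_mul]
    rw [Finsupp.prod_fintype _ _ (by simp), Finsupp.prod_fintype _ _ (by simp)]
    simp [mul_pow, Finset.prod_mul_distrib]

theorem trace_extPower (R : Representation ℂ G V) (g : G) {ι : Type*} [Fintype ι] [LinearOrder ι]
    (b : Module.Basis ι ℂ V) (l : ι → ℂ) (h : ∀ i, R g (b i) = l i • b i) (m : ℕ) :
    (extPower R m).character g = ∑ s ∈ Finset.univ.powersetCard m, ∏ i ∈ s, l i := by
  rw [Representation.character, trace_eq_sum_of_eigenbasis (b.exteriorPower m) _
    fun s => ∏ i ∈ s.1, l i]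
  · refine (Finset.sum_subtype _ (fun s => ?_) (fun s : Finset ι => ∏ i ∈ s, l i)).symm
    simp
  · intro s
    rw [exteriorPower.basis_apply]
    change exteriorPower.map m (R g) _ = _
    rw [exteriorPower.map_apply_ιMulti_family]
    have h1 : exteriorPower.ιMulti_family ℂ m (R g ∘ b) s = exteriorPower.ιMulti ℂ m
        fun k => l (Set.powersetCard.ofFinEmbEquiv.symm s k) •
          b (Set.powersetCard.ofFinEmbEquiv.symm s k) := by
      rw [exteriorPower.ιMulti_family]
      congr 1
      ext k
      simp [h]
    rw [h1, AlternatingMap.map_smul_univ]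
    congr 1
    rw [← Finset.prod_coe_sort s.1]
    exact Fintype.prod_equiv (s.1.orderIsoOfFin s.2).toEquiv _ _ fun k => rfl

variable [FiniteDimensional ℂ V]

/-- The polynomial `∑ m, tr (Λ^m g) (-q)^m`, that is, `det (1 - q g)`. -/
def detPoly (R : Representation ℂ G V) (g : G) : Polynomial ℂ :=
  ∑ m ∈ Finset.range (Module.finrank ℂ V + 1),
    Polynomial.C ((extPower R m).character g) * (-Polynomial.X) ^ m

omit [FiniteDimensional ℂ V] in
theorem detPoly_eq_prod (R : Representation ℂ G V) (g : G)
    (b : Module.Basis (Fin (Module.finrank ℂ V)) ℂ V) (l : Fin (Module.finrank ℂ V) → ℂ)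
    (h : ∀ i, R g (b i) = l i • b i) :
    detPoly R g = ∏ i, (1 - Polynomial.C (l i) * Polynomial.X) := by
  have h1 : ∀ i, (1 - Polynomial.C (l i) * Polynomial.X) =
      1 + Polynomial.C (l i) * (-Polynomial.X) := fun i => by ring
  simp only [detPoly, h1, Finset.prod_one_add, trace_extPower R g b l h]
  rw [← Finset.sum_fiberwise_of_maps_to (s := Finset.univ.powerset)
    (t := Finset.range (Module.finrank ℂ V + 1)) (g := Finset.card)]
  · refine Finset.sum_congr rfl fun m _ => ?_
    rw [map_sum, Finset.sum_mul, ← Finset.powersetCard_eq_filter]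
    refine Finset.sum_congr rfl fun s hs => ?_
    rw [Finset.prod_mul_distrib, Finset.prod_const, (Finset.mem_powersetCard.mp hs).2, map_prod]
  · intro s _
    simpa [Nat.lt_succ_iff] using Finset.card_le_univ s

variable [Finite G]

theorem detPoly_eval_one (R : Representation ℂ G V) (g : G) :
    (detPoly R g).eval 1 = LinearMap.det (1 - R g) := by
  obtain ⟨b, l, hb, -⟩ := exists_eigenbasis R g
  rw [detPoly_eq_prod R g b l hb, det_eq_prod_of_eigenbasis b _ fun i => 1 - l i]
  · simp [Polynomial.eval_prod]
  · intro i
    simp [hb, sub_smul]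

/-- Molien's identity `∑ m, tr (S^m g) q^m = 1 / det (1 - q g)`. -/
theorem detPoly_mul_mk_symPower (R : Representation ℂ G V) (g : G) :
    (detPoly R g : PowerSeries ℂ) * PowerSeries.mk (fun m => (symPower R m).character g) = 1 := by
  obtain ⟨b, l, hb, -⟩ := exists_eigenbasis R g
  have h := mk_sum_finsuppAntidiag_mul_prod l (fun _ => 1) fun _ => one_pos
  simp only [isUnit_one, IsUnit.dvd, if_true, Nat.div_one, pow_one] at h
  simp only [trace_symPower R g b l hb]
  rw [mul_comm, ← h, detPoly_eq_prod R g b l hb]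
  congr 1
  rw [← Polynomial.coeToPowerSeries.ringHom_apply, map_prod]
  simp

end Traces

/-! ### Residues of rational functions -/

section Residues

theorem residue_sum {ι : Type*} (s : Finset ι) (a : ℂ) (f : ι → RatFunc ℂ) :
    residue a (∑ i ∈ s, f i) = ∑ i ∈ s, residue a (f i) := by
  simp only [residue, map_sum, HahnSeries.coeff_sum]

theorem coe_C_eq (c : ℂ) : ((RatFunc.C c : RatFunc ℂ) : LaurentSeries ℂ) =
    ((PowerSeries.C c : PowerSeries ℂ) : LaurentSeries ℂ) := by
  rw [← RatFunc.algebraMap_C, ← RatFunc.coePolynomial_eq_algebraMap, ← RatFunc.coe_coe,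
    Polynomial.coe_C]

/-- A simple pole at `1`: if `f = c / p` with `p 1 ≠ 0`, then `f / (1 - q)` has residue
`- f 1`. -/
theorem residue_one_div_one_sub_X (c : ℂ) (p : Polynomial ℂ) (hp : p.eval 1 ≠ 0) :
    residue 1 (RatFunc.C c / (p : RatFunc ℂ) / (1 - RatFunc.X)) = -(c / p.eval 1) := by
  set t := Polynomial.taylor 1 p with ht
  have ht0 : PowerSeries.constantCoeff (t : PowerSeries ℂ) = p.eval 1 := by
    rw [← PowerSeries.coeff_zero_eq_constantCoeff_apply, Polynomial.coeff_coe, ht,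
      Polynomial.taylor_coeff_zero]
  have hinv : (t : PowerSeries ℂ) * (t : PowerSeries ℂ)⁻¹ = 1 :=
    PowerSeries.mul_inv_cancel _ (by rw [ht0]; exact hp)
  have hinv' : ((t : RatFunc ℂ) : LaurentSeries ℂ)⁻¹ =
      (((t : PowerSeries ℂ)⁻¹ : PowerSeries ℂ) : LaurentSeries ℂ) := by
    rw [← RatFunc.coe_coe]
    refine inv_eq_of_mul_eq_one_right ?_
    rw [← PowerSeries.coe_mul, hinv, PowerSeries.coe_one]
  have h1 : RatFunc.laurent 1 (RatFunc.C c / (p : RatFunc ℂ) / (1 - RatFunc.X)) =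
      RatFunc.C (-c) * (t : RatFunc ℂ)⁻¹ * RatFunc.X⁻¹ := by
    have hX : (1 - (RatFunc.X + RatFunc.C 1) : RatFunc ℂ) = -RatFunc.X := by simp
    rw [map_div₀, map_div₀, map_sub, map_one, RatFunc.laurent_X, RatFunc.laurent_C, hX,
      RatFunc.coePolynomial_eq_algebraMap, RatFunc.laurent_algebraMap, ← ht,
      RatFunc.coePolynomial_eq_algebraMap, map_neg]
    ring
  rw [residue, h1, map_mul, map_mul, map_inv₀, map_inv₀, hinv', coe_C_eq, ← PowerSeries.coe_mul,
    RatFunc.coe_X, HahnSeries.inv_single, HahnSeries.coeff_mul_single, sub_neg_eq_add,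
    neg_add_cancel, inv_one, mul_one, ← Nat.cast_zero, LaurentSeries.coeff_coe_powerSeries,
    PowerSeries.coeff_zero_eq_constantCoeff_apply, map_mul, PowerSeries.constantCoeff_C,
    PowerSeries.constantCoeff_inv, ht0, neg_mul, div_eq_mul_inv]

end Residues

/-! ### The rational functions of symmetric powers -/

section Molien

variable {G V : Type*} [Group G] [Fintype G] [AddCommGroup V] [Module ℂ V] [FiniteDimensional ℂ V]
  {n : ℕ} {W : Fin (n + 1) → Type*} [∀ i, AddCommGroup (W i)] [∀ i, Module ℂ (W i)]

/-- The rational function `|G|⁻¹ ∑ g, χ_i(g) χ_j(g⁻¹) / det (1 - q g)`, which sums the series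
`cgSym ρ R i j`. -/
def cgRat (ρ : ∀ i, Representation ℂ G (W i)) (R : Representation ℂ G V) :
    Matrix (Fin (n + 1)) (Fin (n + 1)) (RatFunc ℂ) :=
  Matrix.of fun i j => RatFunc.C (Nat.card G : ℂ)⁻¹ *
    ∑ g, RatFunc.C ((ρ i).character g * (ρ j).character g⁻¹) / (detPoly R g : RatFunc ℂ)

variable [∀ i, FiniteDimensional ℂ (W i)]

theorem isExpansion_cgRat (ρ : ∀ i, Representation ℂ G (W i)) (R : Representation ℂ G V)
    (i j : Fin (n + 1)) : IsExpansion (cgRat ρ R i j) (cgSym ρ R i j) := by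
  have h1 : ∀ g, ((detPoly R g : RatFunc ℂ) : LaurentSeries ℂ)⁻¹ =
      ((PowerSeries.mk fun m => (symPower R m).character g : PowerSeries ℂ) : LaurentSeries ℂ) := by
    intro g
    rw [← RatFunc.coe_coe]
    refine inv_eq_of_mul_eq_one_right ?_
    rw [← PowerSeries.coe_mul, detPoly_mul_mk_symPower, PowerSeries.coe_one]
  have h2 : cgSym ρ R i j = PowerSeries.C (Nat.card G : ℂ)⁻¹ *
      ∑ g, PowerSeries.C ((ρ i).character g * (ρ j).character g⁻¹) *
        PowerSeries.mk fun m => (symPower R m).character g := by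
    ext m
    rw [cgSym, Matrix.of_apply, PowerSeries.coeff_mk, cgMatrix_eq_sum, PowerSeries.coeff_C_mul,
      map_sum]
    congr 1
    refine Finset.sum_congr rfl fun g _ => ?_
    rw [PowerSeries.coeff_C_mul, PowerSeries.coeff_mk, mul_comm]
  rw [IsExpansion, h2, cgRat, Matrix.of_apply]
  simp only [map_mul, map_sum, div_eq_mul_inv, map_inv₀, h1, ← coe_C_eq]

variable {ρ : ∀ i, Representation ℂ G (W i)}

/-- After the dimensions are divided out, the combination has the coefficients
`(1 - χ_i(g) / d_i) (1 - χ_j(g⁻¹) / d_j)`. The one at the identity vanishes, and it belongs to the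
only term `1 / det (1 - q g)` that can have a pole at `q = 1`. -/
theorem residue_cgRat [DecidableEq G] (hρ : IsIrrepList ρ) (R : Representation ℂ G V)
    (hdet : ∀ g, g ≠ 1 → LinearMap.det (1 - R g) ≠ 0) (i j : Fin (n + 1)) :
    -((Module.finrank ℂ (W i) : ℂ) * (Module.finrank ℂ (W j) : ℂ)) * residue 1
      ((cgRat ρ R 0 0 - cgRat ρ R i 0 / (Module.finrank ℂ (W i) : RatFunc ℂ) -
        cgRat ρ R 0 j / (Module.finrank ℂ (W j) : RatFunc ℂ) +
        cgRat ρ R i j / ((Module.finrank ℂ (W i) : RatFunc ℂ) *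
          (Module.finrank ℂ (W j) : RatFunc ℂ))) / (1 - RatFunc.X)) =
      (Nat.card G : ℂ)⁻¹ * ∑ g, if g = 1 then 0 else
        ((ρ i).character g - (Module.finrank ℂ (W i) : ℂ)) *
          ((ρ j).character g⁻¹ - (Module.finrank ℂ (W j) : ℂ)) / LinearMap.det (1 - R g) := by
  have hi := hρ.finrank_ne_zero i
  have hj := hρ.finrank_ne_zero j
  set di := Module.finrank ℂ (W i)
  set dj := Module.finrank ℂ (W j)
  have hdi : (di : RatFunc ℂ) = RatFunc.C (di : ℂ) := by simp
  have hdj : (dj : RatFunc ℂ) = RatFunc.C (dj : ℂ) := by simp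
  let c : G → ℂ := fun g => (Nat.card G : ℂ)⁻¹ *
    ((1 - (ρ i).character g / di) * (1 - (ρ j).character g⁻¹ / dj))
  have h1 : (cgRat ρ R 0 0 - cgRat ρ R i 0 / (di : RatFunc ℂ) - cgRat ρ R 0 j / (dj : RatFunc ℂ) +
        cgRat ρ R i j / ((di : RatFunc ℂ) * (dj : RatFunc ℂ))) / (1 - RatFunc.X) =
      ∑ g, if g = 1 then 0 else RatFunc.C (c g) / (detPoly R g : RatFunc ℂ) / (1 - RatFunc.X) := by
    have h2 : ∀ g, (if g = 1 then 0 else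
        RatFunc.C (c g) / (detPoly R g : RatFunc ℂ) / (1 - RatFunc.X)) =
        RatFunc.C (c g) / (detPoly R g : RatFunc ℂ) / (1 - RatFunc.X) := by
      intro g
      split_ifs with hg
      · subst hg
        have : c 1 = 0 := by simp [c, di, hi]
        simp [this]
      · rfl
    simp only [h2, ← Finset.sum_div]
    congr 1
    simp only [cgRat, Matrix.of_apply, hdi, hdj, mul_div_assoc, Finset.sum_div, Finset.mul_sum,
      ← Finset.sum_sub_distrib, ← Finset.sum_add_distrib]
    refine Finset.sum_congr rfl fun g _ => ?_
    simp only [c, hρ.character_zero, map_mul, map_sub, map_one, map_div₀]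
    ring
  rw [h1, residue_sum, Finset.mul_sum, Finset.mul_sum]
  refine Finset.sum_congr rfl fun g _ => ?_
  split_ifs with hg
  · simp [residue]
  · rw [residue_one_div_one_sub_X _ _ (by rw [detPoly_eval_one]; exact hdet g hg),
      detPoly_eval_one]
    simp only [c]
    have := hdet g hg
    field_simp
    ring

end Molien

/-! ### Counting weighted exponent vectors -/

section Counting

variable {ι : Type*} [Fintype ι] [DecidableEq ι]

/-- Multiplying the exponents by the weights identifies the exponent vectors of weight `m` with
the vectors of sum `m` whose entries are divisible by the weights. -/
def weightEquiv (w : ι → ℕ) (hw : ∀ i, 0 < w i) (m : ℕ) :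
    {α : ι →₀ ℕ // ∑ i, α i * w i = m} ≃
      ((Finset.univ.finsuppAntidiag m).filter fun β : ι →₀ ℕ => ∀ i, w i ∣ β i) where
  toFun α := ⟨Finsupp.equivFunOnFinite.symm fun i => α.1 i * w i, by
    simpa [Finset.mem_finsuppAntidiag] using α.2⟩
  invFun β := ⟨Finsupp.equivFunOnFinite.symm fun i => β.1 i / w i, by
    obtain ⟨β, hβ⟩ := β
    rw [Finset.mem_filter, Finset.mem_finsuppAntidiag] at hβ
    refine Eq.trans ?_ hβ.1.1
    exact Finset.sum_congr rfl fun i _ => Nat.div_mul_cancel (hβ.2 i)⟩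
  left_inv α := by
    ext i
    simp [Nat.mul_div_cancel _ (hw i)]
  right_inv β := by
    ext i
    exact Nat.div_mul_cancel ((Finset.mem_filter.mp β.2).2 i)

theorem mk_card_mul_prod (w : ι → ℕ) (hw : ∀ i, 0 < w i) :
    PowerSeries.mk (fun m => (Nat.card {α : ι →₀ ℕ // ∑ i, α i * w i = m} : ℂ)) *
      ∏ i, (1 - (PowerSeries.X : PowerSeries ℂ) ^ w i) = 1 := by
  have h := mk_sum_finsuppAntidiag_mul_prod (fun _ : ι => (1 : ℂ)) w hw
  simp only [map_one, one_mul, one_pow] at h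
  refine Eq.trans ?_ h
  congr 1
  ext m
  rw [PowerSeries.coeff_mk, PowerSeries.coeff_mk, Nat.card_congr (weightEquiv w hw m),
    Nat.card_eq_fintype_card, Fintype.card_coe,
    Finset.card_filter, Nat.cast_sum]
  refine Finset.sum_congr rfl fun β _ => ?_
  rw [Finset.prod_ite_zero]
  simp

/-- Hilbert series of a free graded module over a weighted polynomial ring. -/
theorem mk_card_prod_mul_prod (w : ι → ℕ) (hw : ∀ i, 0 < w i) {κ : Type*} [Fintype κ]
    (e : κ → ℕ) :
    PowerSeries.mk (fun m => (Nat.card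
        {p : (ι →₀ ℕ) × κ // ∑ i, p.1 i * w i + e p.2 = m} : ℂ)) *
      ∏ i, (1 - (PowerSeries.X : PowerSeries ℂ) ^ w i) = ∑ k, PowerSeries.X ^ e k := by
  have h : PowerSeries.mk (fun m => (Nat.card
        {p : (ι →₀ ℕ) × κ // ∑ i, p.1 i * w i + e p.2 = m} : ℂ)) =
      (∑ k, PowerSeries.X ^ e k) *
        PowerSeries.mk (fun m => (Nat.card {α : ι →₀ ℕ // ∑ i, α i * w i = m} : ℂ)) := by
    ext m
    rw [Finset.sum_mul, map_sum, PowerSeries.coeff_mk]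
    let E : {p : (ι →₀ ℕ) × κ // ∑ i, p.1 i * w i + e p.2 = m} ≃
        Σ k, {α : ι →₀ ℕ // ∑ i, α i * w i + e k = m} :=
      { toFun := fun p => ⟨p.1.2, p.1.1, p.2⟩
        invFun := fun p => ⟨(p.2.1, p.1), p.2.2⟩
        left_inv := fun _ => rfl
        right_inv := fun _ => rfl }
    have hE : ∀ k (hk : e k ≤ m), Nat.card {α : ι →₀ ℕ // ∑ i, α i * w i + e k = m} =
        Nat.card {α : ι →₀ ℕ // ∑ i, α i * w i = m - e k} := fun k hk =>
      Nat.card_congr (Equiv.subtypeEquivRight fun α => by omega)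
    have hempty : ∀ k (hk : ¬ e k ≤ m), IsEmpty {α : ι →₀ ℕ // ∑ i, α i * w i + e k = m} :=
      fun k hk => ⟨fun α => by have := α.2; omega⟩
    have hfin : ∀ k, Finite {α : ι →₀ ℕ // ∑ i, α i * w i + e k = m} := by
      intro k
      by_cases hk : e k ≤ m
      · exact Finite.of_equiv _ ((Equiv.subtypeEquivRight fun α => by omega).trans
          (weightEquiv w hw (m - e k))).symm
      · have := hempty k hk
        infer_instance
    rw [Nat.card_congr E, Nat.card_sigma, Nat.cast_sum]
    refine Finset.sum_congr rfl fun k _ => ?_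
    rw [PowerSeries.coeff_X_pow_mul', PowerSeries.coeff_mk]
    split_ifs with hk
    · rw [hE k hk]
    · have := hempty k hk
      simp
  rw [h, mul_assoc, mk_card_mul_prod w hw, mul_one]

end Counting

/-! ### Graded dimensions of the modules of covariants -/

section GradedPieces

/-- Here `p` is the projection to degree `m` of the embedding `e` of `M` in a graded space: it
agrees with `e` on the part `N` of degree `m` and kills the basis vectors of other degrees. Then
`dim N` is the number of basis vectors of degree `m`. -/
theorem finrank_eq_card_of_homogeneous_basis {M M' ι : Type*} [AddCommMonoid M] [Module ℂ M]
    [AddCommMonoid M'] [Module ℂ M'] (B : Module.Basis ι ℂ M) (deg : ι → ℕ) (m : ℕ)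
    (N : Submodule ℂ M) (e p : M →ₗ[ℂ] M') (he : Function.Injective e)
    (hN : ∀ x ∈ N, p x = e x) (hB : ∀ i, deg i = m → B i ∈ N)
    (hB0 : ∀ i, deg i ≠ m → p (B i) = 0) :
    Module.finrank ℂ N = Nat.card {i // deg i = m} := by
  have hspan : N = Submodule.span ℂ (Set.range fun i : {i // deg i = m} => B i) := by
    refine le_antisymm (fun x hx => ?_) ?_
    · have h1 : ∀ y,
          p y ∈ (Submodule.span ℂ (Set.range fun i : {i // deg i = m} => B i)).map e := by
        intro y
        have hy : y ∈ Submodule.span ℂ (Set.range B) := B.mem_span y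
        induction hy using Submodule.span_induction with
        | mem y hy =>
          obtain ⟨i, rfl⟩ := hy
          by_cases hi : deg i = m
          · rw [hN _ (hB i hi)]
            exact ⟨B i, Submodule.subset_span ⟨⟨i, hi⟩, rfl⟩, rfl⟩
          · rw [hB0 i hi]; exact zero_mem _
        | zero => rw [map_zero]; exact zero_mem _
        | add y z _ _ hy hz => rw [map_add]; exact add_mem hy hz
        | smul c y _ hy => rw [map_smul]; exact Submodule.smul_mem _ c hy
      obtain ⟨z, hz, hzx⟩ := h1 x
      rw [hN x hx] at hzx
      exact he hzx ▸ hz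
    · rw [Submodule.span_le]
      rintro _ ⟨i, rfl⟩
      exact hB i i.2
  rw [hspan]
  exact Module.finrank_eq_nat_card_basis
    (Module.Basis.span (B.linearIndependent.comp _ Subtype.val_injective))

variable {G V : Type*} [Group G] [AddCommGroup V] [Module ℂ V]

theorem mul_mem_symDegree {a b : ℕ} {x y : SymmetricAlgebra ℂ V} (hx : x ∈ symDegree V a)
    (hy : y ∈ symDegree V b) : x * y ∈ symDegree V (a + b) := by
  rw [symDegree, pow_add]
  exact Submodule.mul_mem_mul hx hy

theorem prod_pow_mem_symDegree {ι : Type*} (s : Finset ι) (x : ι → SymmetricAlgebra ℂ V)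
    (w α : ι → ℕ) (hx : ∀ i, x i ∈ symDegree V (w i)) :
    ∏ i ∈ s, x i ^ α i ∈ symDegree V (∑ i ∈ s, α i * w i) := by
  classical
  induction s using Finset.induction_on with
  | empty => simp [symDegree, Submodule.one_le.mp le_rfl]
  | insert i s hi ih =>
    rw [Finset.prod_insert hi, Finset.sum_insert hi]
    refine mul_mem_symDegree ?_ ih
    rw [symDegree, mul_comm, pow_mul]
    exact Submodule.pow_mem_pow _ (hx i) _

variable [FiniteDimensional ℂ V]

/-- The projection of the symmetric algebra onto its part of degree `m`. -/
def symProj (V : Type*) [AddCommGroup V] [Module ℂ V] [FiniteDimensional ℂ V] (m : ℕ) :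
    SymmetricAlgebra ℂ V →ₗ[ℂ] SymmetricAlgebra ℂ V :=
  (SymmetricAlgebra.equivMvPolynomial (Module.finBasis ℂ V)).symm.toLinearMap ∘ₗ
    MvPolynomial.homogeneousComponent m ∘ₗ
      (SymmetricAlgebra.equivMvPolynomial (Module.finBasis ℂ V)).toLinearMap

theorem symProj_apply {a : ℕ} {x : SymmetricAlgebra ℂ V} (hx : x ∈ symDegree V a) (m : ℕ) :
    symProj V m x = if a = m then x else 0 := by
  have h : SymmetricAlgebra.equivMvPolynomial (Module.finBasis ℂ V) x ∈
      MvPolynomial.homogeneousSubmodule _ ℂ a :=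
    map_symDegree_equivMvPolynomial (Module.finBasis ℂ V) a ▸ Submodule.mem_map_of_mem hx
  simp only [symProj, LinearMap.comp_apply, AlgEquiv.toLinearMap_apply,
    MvPolynomial.homogeneousComponent_of_mem h, eq_comm (a := m)]
  split_ifs <;> simp

end GradedPieces

section Covariants

variable {G V : Type*} [Group G] [AddCommGroup V] [Module ℂ V]
  {U : Type*} [AddCommGroup U] [Module ℂ U]

/-- The covariants of degree `m`. -/
def covariantsDegree (R : Representation ℂ G V) (σ : Representation ℂ G U) (m : ℕ) :
    Submodule ℂ (covariants R σ) where
  carrier := {f | ∀ u, (f : U →ₗ[ℂ] SymmetricAlgebra ℂ V) u ∈ symDegree V m}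
  add_mem' hf hf' u := add_mem (hf u) (hf' u)
  zero_mem' _ := zero_mem _
  smul_mem' a _ hf u := Submodule.smul_mem _ a (hf u)

/-- Covariants of degree `m` are equivariant maps to the symmetric power. -/
def covariantsDegreeEquiv (R : Representation ℂ G V) (σ : Representation ℂ G U) (m : ℕ) :
    covariantsDegree R σ m ≃ₗ[ℂ] Representation.IntertwiningMap σ (symPower R m) where
  toFun f := ⟨(f.1 : U →ₗ[ℂ] SymmetricAlgebra ℂ V).codRestrict _ f.2, fun g => by
    ext u
    exact f.1.2 g u⟩
  invFun f := ⟨⟨(symDegree V m).subtype ∘ₗ f.toLinearMap, fun g u => by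
    exact congrArg Subtype.val (f.isIntertwining _ _ g u)⟩, fun u => (f u).2⟩
  left_inv f := rfl
  right_inv f := rfl
  map_add' f f' := rfl
  map_smul' a f := rfl

variable {n : ℕ} {W : Fin (n + 1) → Type*} [∀ i, AddCommGroup (W i)]
  [∀ i, Module ℂ (W i)] {ρ : ∀ i, Representation ℂ G (W i)} {R : Representation ℂ G V}

instance (S : Subalgebra ℂ (invariants R)) (σ : Representation ℂ G U) :
    IsScalarTower ℂ S (covariants R σ) where
  smul_assoc r a x := by
    refine Subtype.ext (LinearMap.ext fun u => ?_)
    exact smul_mul_assoc r ((a : invariants R) : SymmetricAlgebra ℂ V) ((x : U →ₗ[ℂ] _) u)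

/-- The complex basis of a module of covariants consisting of the products of the monomials in
the parameters with the module generators. -/
def CMData.basis (c : CMData ρ R) (j : Fin (n + 1)) :
    Module.Basis ((Fin (Module.finrank ℂ V) →₀ ℕ) × Fin (c.μ j)) ℂ (covariants R (ρ j)) :=
  ((MvPolynomial.basisMonomials _ ℂ).map
    c.algebraicIndependent.aevalEquiv.toLinearEquiv).smulTower (c.gen j)

theorem CMData.basis_apply (c : CMData ρ R) (j : Fin (n + 1))
    (p : (Fin (Module.finrank ℂ V) →₀ ℕ) × Fin (c.μ j)) (u : W j) :
    (c.basis j p : W j →ₗ[ℂ] SymmetricAlgebra ℂ V) u =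
      (∏ i, (c.θ i : SymmetricAlgebra ℂ V) ^ p.1 i) *
        (c.gen j p.2 : W j →ₗ[ℂ] SymmetricAlgebra ℂ V) u := by
  have h1 : ((((MvPolynomial.basisMonomials _ ℂ).map
      c.algebraicIndependent.aevalEquiv.toLinearEquiv p.1 :
        Algebra.adjoin ℂ (Set.range c.θ)) : invariants R) : SymmetricAlgebra ℂ V) =
      ∏ i, (c.θ i : SymmetricAlgebra ℂ V) ^ p.1 i := by
    rw [Module.Basis.map_apply, MvPolynomial.coe_basisMonomials, AlgEquiv.toLinearEquiv_apply]
    refine (congrArg Subtype.val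
      (c.algebraicIndependent.algebraMap_aevalEquiv (MvPolynomial.monomial p.1 1))).trans ?_
    rw [MvPolynomial.aeval_monomial, map_one, one_mul, Finsupp.prod_fintype _ _ (by simp)]
    simp
  rw [← h1, CMData.basis, Module.Basis.smulTower_apply]
  rfl

theorem CMData.basis_mem (c : CMData ρ R) (j : Fin (n + 1))
    (p : (Fin (Module.finrank ℂ V) →₀ ℕ) × Fin (c.μ j)) :
    c.basis j p ∈ covariantsDegree R (ρ j) (∑ i, p.1 i * c.degθ i + c.degGen j p.2) := by
  intro u
  rw [CMData.basis_apply]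
  exact mul_mem_symDegree (prod_pow_mem_symDegree _ _ _ _ c.θ_mem) (c.gen_mem j p.2 u)

/-- The inclusion of the covariants into all linear maps. -/
def covariantsVal (R : Representation ℂ G V) (σ : Representation ℂ G U) :
    covariants R σ →ₗ[ℂ] (U →ₗ[ℂ] SymmetricAlgebra ℂ V) :=
  (covariants R σ).subtype.restrictScalars ℂ

variable [FiniteDimensional ℂ V]

/-- The degree `m` component of a covariant, as a linear map. -/
def covariantsProj (R : Representation ℂ G V) (σ : Representation ℂ G U) (m : ℕ) :
    covariants R σ →ₗ[ℂ] (U →ₗ[ℂ] SymmetricAlgebra ℂ V) :=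
  LinearMap.compRight ℂ (symProj V m) ∘ₗ covariantsVal R σ

theorem covariantsProj_of_mem (R : Representation ℂ G V) (σ : Representation ℂ G U) {a : ℕ} (m : ℕ)
    (f : covariants R σ) (hf : f ∈ covariantsDegree R σ a) :
    covariantsProj R σ m f = if a = m then covariantsVal R σ f else 0 := by
  ext u
  have h : covariantsProj R σ m f u = if a = m then covariantsVal R σ f u else 0 :=
    symProj_apply (hf u) m
  rw [h]
  split_ifs <;> rfl

theorem CMData.finrank_covariantsDegree (c : CMData ρ R) (j : Fin (n + 1)) (m : ℕ) :
    Module.finrank ℂ (covariantsDegree R (ρ j) m) =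
      Nat.card {p : (Fin (Module.finrank ℂ V) →₀ ℕ) × Fin (c.μ j) //
        ∑ i, p.1 i * c.degθ i + c.degGen j p.2 = m} := by
  refine finrank_eq_card_of_homogeneous_basis (c.basis j)
    (fun a => ∑ i, a.1 i * c.degθ i + c.degGen j a.2) m (covariantsDegree R (ρ j) m)
    (covariantsVal R (ρ j)) (covariantsProj R (ρ j) m) ?_ ?_ ?_ ?_
  · exact fun x y h => Subtype.ext h
  · intro x hx
    rw [covariantsProj_of_mem R (ρ j) m x hx, if_pos rfl]
  · rintro a rfl
    exact c.basis_mem j a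
  · intro a ha
    rw [covariantsProj_of_mem R (ρ j) m _ (c.basis_mem j a), if_neg ha]

variable [Fintype G] [∀ i, FiniteDimensional ℂ (W i)]

/-- The Hilbert series of the modules of covariants. -/
theorem CMData.cgSym_zero_mul (c : CMData ρ R) (hρ : IsIrrepList ρ) (j : Fin (n + 1)) :
    cgSym ρ R 0 j * ∏ k, (1 - (PowerSeries.X : PowerSeries ℂ) ^ c.degθ k) =
      (c.numer₀ j : PowerSeries ℂ) := by
  have h : cgSym ρ R 0 j = PowerSeries.mk fun m => (Nat.card
      {p : (Fin (Module.finrank ℂ V) →₀ ℕ) × Fin (c.μ j) //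
        ∑ i, p.1 i * c.degθ i + c.degGen j p.2 = m} : ℂ) := by
    ext m
    rw [cgSym, Matrix.of_apply, PowerSeries.coeff_mk, PowerSeries.coeff_mk,
      ← c.finrank_covariantsDegree, (covariantsDegreeEquiv R (ρ j) m).finrank_eq,
      finrank_intertwiningMap_eq_cgMatrix hρ]
  rw [h, mk_card_prod_mul_prod _ c.degθ_pos, CMData.numer₀,
    ← Polynomial.coeToPowerSeries.ringHom_apply, map_sum]
  simp

theorem CMData.cgSym_mul (c : CMData ρ R) (hρ : IsIrrepList ρ) (i j : Fin (n + 1)) :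
    cgSym ρ R i j * ∏ k, (1 - (PowerSeries.X : PowerSeries ℂ) ^ c.degθ k) =
      (c.numer i j : PowerSeries ℂ) := by
  have h : cgSym ρ R i j = ∑ k, PowerSeries.C (cgMatrix ρ (ρ i) k j : ℂ) * cgSym ρ R 0 k := by
    ext m
    simp only [cgSym, Matrix.of_apply, PowerSeries.coeff_mk, map_sum, PowerSeries.coeff_C_mul]
    exact hρ.cgMatrix_eq_sum_mul _ i j
  rw [h, Finset.sum_mul, CMData.numer, Matrix.of_apply,
    ← Polynomial.coeToPowerSeries.ringHom_apply, map_sum]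
  refine Finset.sum_congr rfl fun k _ => ?_
  rw [mul_assoc, c.cgSym_zero_mul hρ, map_mul]
  simp

/-- The rational functions `cgRat` through the Cohen-Macaulay numerators. -/
theorem CMData.cgRat_eq (c : CMData ρ R) (hρ : IsIrrepList ρ) (i j : Fin (n + 1)) :
    cgRat ρ R i j = (c.numer i j : RatFunc ℂ) /
      ((1 - RatFunc.X) ^ Module.finrank ℂ V * (c.denom : RatFunc ℂ)) := by
  have hden : (1 - RatFunc.X) ^ Module.finrank ℂ V * (c.denom : RatFunc ℂ) =
      ((∏ k, (1 - (Polynomial.X : Polynomial ℂ) ^ c.degθ k) : Polynomial ℂ) : RatFunc ℂ) := by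
    rw [← c.denom_spec]
    simp only [RatFunc.coePolynomial_eq_algebraMap, map_mul, map_pow, map_sub, map_one,
      RatFunc.algebraMap_X]
  have hne : (∏ k, (1 - (Polynomial.X : Polynomial ℂ) ^ c.degθ k)) ≠ 0 := by
    rw [Finset.prod_ne_zero_iff]
    intro k _ h0
    have := congrArg (Polynomial.eval 0) h0
    simp [(c.degθ_pos k).ne'] at this
  rw [hden, eq_div_iff (by
    rw [RatFunc.coePolynomial_eq_algebraMap]
    exact (map_ne_zero_iff _ (IsFractionRing.injective _ _)).mpr hne)]
  have hinj : Function.Injective fun f : RatFunc ℂ => (f : LaurentSeries ℂ) :=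
    RingHom.injective _
  apply hinj
  change ((_ * _ : RatFunc ℂ) : LaurentSeries ℂ) =
    ((c.numer i j : RatFunc ℂ) : LaurentSeries ℂ)
  rw [map_mul, isExpansion_cgRat ρ R i j, ← RatFunc.coe_coe, ← RatFunc.coe_coe, ← c.cgSym_mul hρ,
    ← PowerSeries.coe_mul]
  congr 2
  rw [← Polynomial.coeToPowerSeries.ringHom_apply, map_prod]
  simp

end Covariants

/-! ### The inverse of the Euclidean Cartan matrix -/

section Cartan

variable {G V : Type*} [Group G] [Fintype G] [AddCommGroup V] [Module ℂ V] [FiniteDimensional ℂ V]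
  {n : ℕ} {W : Fin (n + 1) → Type*} [∀ i, AddCommGroup (W i)] [∀ i, Module ℂ (W i)]
  [∀ i, FiniteDimensional ℂ (W i)] {ρ : ∀ i, Representation ℂ G (W i)}

omit [Fintype G] in
theorem det_one_sub_ne_zero {R : Representation ℂ G V} {g : G} (hg : ∀ v, R g v = v → v = 0) :
    LinearMap.det (1 - R g) ≠ 0 := by
  intro h
  obtain ⟨v, hv, hv0⟩ := (Submodule.ne_bot_iff _).mp (LinearMap.bot_lt_ker_of_det_eq_zero h).ne'
  refine hv0 (hg v ?_)
  have hv' : v - R g v = 0 := hv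
  exact (sub_eq_zero.mp hv').symm

omit [Fintype G] [FiniteDimensional ℂ V] in
theorem det_one_sub_conj (R : Representation ℂ G V) (g h : G) :
    LinearMap.det (1 - R (h * g * h⁻¹)) = LinearMap.det (1 - R g) := by
  have h1 : (1 : Module.End ℂ V) - R (h * g * h⁻¹) = R h * (1 - R g) * R h⁻¹ := by
    rw [mul_sub, sub_mul, mul_one, ← map_mul, mul_inv_cancel, map_one, map_mul, map_mul]
  have h2 : LinearMap.det (R h) * LinearMap.det (R h⁻¹) = 1 := by
    rw [← map_mul, ← map_mul, mul_inv_cancel, map_one, map_one]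
  rw [h1, map_mul, map_mul, mul_right_comm, h2, one_mul]

theorem euclideanCartan_apply (ρ : ∀ i, Representation ℂ G (W i)) (R : Representation ℂ G V)
    (i j : Fin n) :
    euclideanCartan ρ R i j = (Nat.card G : ℂ)⁻¹ * ∑ g, LinearMap.det (1 - R g) *
      ((ρ i.succ).character g * (ρ j.succ).character g⁻¹) := by
  simp only [euclideanCartan, euclideanCG, cgExtNeg, Matrix.map_apply, Matrix.submatrix_apply,
    Matrix.of_apply, Polynomial.eval_finsetSum, Polynomial.eval_mul, Polynomial.eval_C,
    Polynomial.eval_pow, Polynomial.eval_neg, Polynomial.eval_X, cgMatrix_eq_sum,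
    ← detPoly_eval_one, detPoly, mul_assoc, ← Finset.mul_sum, Finset.sum_mul]
  congr 1
  rw [Finset.sum_comm]
  refine Finset.sum_congr rfl fun g _ => Finset.sum_congr rfl fun m _ => ?_
  ring

variable [DecidableEq G]

/-- The matrix `|G|⁻¹ ∑ g ≠ 1, (χ_i(g) - d_i) (χ_j(g⁻¹) - d_j) / det (1 - g)`. -/
def cartanInverse (ρ : ∀ i, Representation ℂ G (W i)) (R : Representation ℂ G V) :
    Matrix (Fin n) (Fin n) ℂ :=
  Matrix.of fun i j => (Nat.card G : ℂ)⁻¹ * ∑ g, if g = 1 then 0 else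
    ((ρ i.succ).character g - (Module.finrank ℂ (W i.succ) : ℂ)) *
      ((ρ j.succ).character g⁻¹ - (Module.finrank ℂ (W j.succ) : ℂ)) / LinearMap.det (1 - R g)

/-- Multiplication by the Cartan matrix is multiplication of class functions by `det (1 - g)`, in
the coordinates given by the irreducible characters; the correction by the dimensions absorbs its
zero at the identity. -/
theorem euclideanCartan_mul_cartanInverse (hρ : IsIrrepList ρ) (R : Representation ℂ G V)
    (hdet : ∀ g, g ≠ 1 → LinearMap.det (1 - R g) ≠ 0) (hdet1 : LinearMap.det (1 - R 1) = 0) :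
    euclideanCartan ρ R * cartanInverse ρ R = 1 := by
  ext i k
  have hN : (Nat.card G : ℂ) ≠ 0 := by simp [Nat.card_eq_fintype_card]
  set dk : ℂ := (Module.finrank ℂ (W k.succ) : ℂ) with hdk
  set D : G → ℂ := fun g => LinearMap.det (1 - R g) with hD
  -- the quotient of `χ_k(g⁻¹) - d_k` by `det (1 - g)`, extended by zero
  let F : G → ℂ := fun g => if g = 1 then 0 else ((ρ k.succ).character g⁻¹ - dk) / D g
  have hDF : ∀ g, D g * F g = (ρ k.succ).character g⁻¹ - dk := by
    intro g
    simp only [F]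
    split_ifs with hg
    · subst hg; simp [dk]
    · exact mul_div_cancel₀ _ (hdet g hg)
  have hFconj : ∀ g h, F (h * g * h⁻¹) = F g := by
    intro g h
    have h1 : (h * g * h⁻¹)⁻¹ = h * g⁻¹ * h⁻¹ := by group
    have h2 : h * g * h⁻¹ = 1 ↔ g = 1 := by simp [mul_assoc, mul_eq_one_iff_eq_inv']
    simp only [F, D, h1, h2, Representation.char_conj, det_one_sub_conj]
  have hinv : ∀ j : Fin n, cartanInverse ρ R j k = (Nat.card G : ℂ)⁻¹ *
      ∑ h, ((ρ j.succ).character h - (Module.finrank ℂ (W j.succ) : ℂ)) * F h := by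
    intro j
    simp only [cartanInverse, Matrix.of_apply, F, D, mul_ite, mul_zero, mul_div_assoc]
    rfl
  -- the term of the trivial representation vanishes, so that the sum over the nontrivial
  -- irreducible representations is a sum over all of them
  have hcol : ∀ g, ∑ j : Fin n, (ρ j.succ).character g⁻¹ * cartanInverse ρ R j k =
      F g - ((Nat.card G : ℂ)⁻¹ * ∑ h, F h) *
        ∑ j, (Module.finrank ℂ (W j) : ℂ) * (ρ j).character g⁻¹ := by
    intro g
    have h0 : ((ρ 0).character g⁻¹ * ((Nat.card G : ℂ)⁻¹ *
        ∑ h, ((ρ 0).character h - (Module.finrank ℂ (W 0) : ℂ)) * F h)) = 0 := by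
      have h1 : (Module.finrank ℂ (W 0) : ℂ) = 1 := by
        rw [← Representation.char_one (ρ 0), hρ.character_zero]
      simp [hρ.character_zero, h1]
    have hF := hρ.expansion (f := fun h => F h⁻¹) (fun x y => by
      have h1 : (y * x * y⁻¹)⁻¹ = y * x⁻¹ * y⁻¹ := by group
      rw [h1, hFconj]) g⁻¹
    simp only [inv_inv] at hF
    have hsum : ∀ j, ∑ h, F h⁻¹ * (ρ j).character h⁻¹ = ∑ h, F h * (ρ j).character h := fun j =>
      Fintype.sum_equiv (Equiv.inv G) _ _ fun h => rfl
    simp only [hinv]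
    rw [← zero_add (∑ j : Fin n, _), ← h0, ← Fin.sum_univ_succ (fun j => (ρ j).character g⁻¹ *
      ((Nat.card G : ℂ)⁻¹ * ∑ h, ((ρ j).character h - (Module.finrank ℂ (W j) : ℂ)) * F h)), hF,
      Finset.mul_sum, ← Finset.sum_sub_distrib]
    refine Finset.sum_congr rfl fun j _ => ?_
    rw [hsum]
    simp only [sub_mul, Finset.sum_sub_distrib, ← Finset.mul_sum, mul_comm (F _)]
    ring
  have hreg : ∀ g, D g * ∑ j, (Module.finrank ℂ (W j) : ℂ) * (ρ j).character g⁻¹ = 0 := by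
    intro g
    by_cases hg : g = 1
    · subst hg; rw [hD]; simp only [hdet1, zero_mul]
    · rw [hρ.sum_finrank_mul_character (inv_ne_one.mpr hg), mul_zero]
  have hDcol : ∀ g, D g * ∑ j : Fin n, (ρ j.succ).character g⁻¹ * cartanInverse ρ R j k =
      (ρ k.succ).character g⁻¹ - dk := by
    intro g
    rw [hcol, mul_sub, hDF, mul_left_comm, hreg, mul_zero, sub_zero]
  have h1 : (euclideanCartan ρ R * cartanInverse ρ R) i k = (Nat.card G : ℂ)⁻¹ *
      ∑ g, (ρ i.succ).character g * ((ρ k.succ).character g⁻¹ - dk) := by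
    rw [Matrix.mul_apply]
    simp only [euclideanCartan_apply, mul_assoc, ← Finset.mul_sum, Finset.sum_mul]
    rw [Finset.sum_comm]
    congr 1
    refine Finset.sum_congr rfl fun g _ => ?_
    rw [← hDcol, Finset.mul_sum, Finset.mul_sum]
    refine Finset.sum_congr rfl fun j _ => ?_
    simp only [D]
    ring
  have h2 : (Nat.card G : ℂ)⁻¹ * ∑ g, (ρ i.succ).character g = 0 := by
    have := hρ.sum_character_mul_character_inv i.succ 0
    simpa [hρ.character_zero, Fin.succ_ne_zero] using this
  have h3 := hρ.sum_character_mul_character_inv i.succ k.succ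
  rw [h1]
  simp only [mul_sub, Finset.sum_sub_distrib, h3, ← Finset.sum_mul, ← mul_assoc, h2, zero_mul,
    sub_zero, Matrix.one_apply, Fin.succ_inj]

omit [DecidableEq G] in
/-- For the trivial group there are no nontrivial irreducible representations. -/
theorem IsIrrepList.eq_zero_of_subsingleton [Subsingleton G] (hρ : IsIrrepList ρ) : n = 0 := by
  by_contra hn
  obtain ⟨m, rfl⟩ := Nat.exists_eq_succ_of_ne_zero hn
  have h := hρ.sum_character_mul_character_inv (Fin.last _) 0
  have hN : (Nat.card G : ℂ) ≠ 0 := by simp [Nat.card_eq_fintype_card]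
  have h1 : ∀ g : G, (ρ (Fin.last _)).character g = Module.finrank ℂ (W (Fin.last _)) := fun g => by
    rw [Subsingleton.elim g 1, Representation.char_one]
  simp [hρ.character_zero, h1, hρ.finrank_ne_zero] at h

theorem isUnit_euclideanCartan_and_inv_eq (hρ : IsIrrepList ρ) (R : Representation ℂ G V)
    (hinj : Function.Injective R) (hfree : ∀ g, g ≠ 1 → ∀ v, R g v = v → v = 0) :
    IsUnit (euclideanCartan ρ R) ∧ (euclideanCartan ρ R)⁻¹ = cartanInverse ρ R := by
  have hmul : euclideanCartan ρ R * cartanInverse ρ R = 1 := by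
    -- for the trivial group `V` may be zero, and then `det (1 - g)` does not vanish at `g = 1`
    rcases subsingleton_or_nontrivial G with hG | hG
    · obtain rfl := hρ.eq_zero_of_subsingleton
      exact Subsingleton.elim _ _
    · refine euclideanCartan_mul_cartanInverse hρ R
        (fun g hg => det_one_sub_ne_zero (hfree g hg)) ?_
      have hV : Nontrivial V := by
        by_contra hV
        rw [not_nontrivial_iff_subsingleton] at hV
        obtain ⟨g, hg⟩ := exists_ne (1 : G)
        exact hg (hinj (LinearMap.ext fun v => Subsingleton.elim _ _))
      rw [map_one, sub_self, LinearMap.det_zero, zero_pow Module.finrank_pos.ne']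
  exact ⟨(Matrix.isUnit_iff_isUnit_det _).mpr
    (Matrix.isUnit_det_of_right_inverse hmul), Matrix.inv_eq_right_inv hmul⟩

omit [FiniteDimensional ℂ V] in
/-- The entries of the inverse as sums over the nontrivial conjugacy classes. -/
theorem cartanInverse_apply [Fintype (ConjClasses G)] [DecidableEq (ConjClasses G)]
    (ρ : ∀ i, Representation ℂ G (W i)) (R : Representation ℂ G V) {rep : ConjClasses G → G}
    (hrep : ∀ C, ConjClasses.mk (rep C) = C) (i j : Fin n) :
    cartanInverse ρ R i j =
      (Nat.card G : ℂ)⁻¹ * ∑ C ∈ Finset.univ.erase (ConjClasses.mk (1 : G)),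
        (Nat.card C.carrier : ℂ) *
          ((ρ i.succ).character (rep C) - (Module.finrank ℂ (W i.succ) : ℂ)) *
          ((starRingEnd ℂ) ((ρ j.succ).character (rep C)) - (Module.finrank ℂ (W j.succ) : ℂ)) /
          LinearMap.det (1 - R (rep C)) := by
  have hrep1 : ∀ C, rep C = 1 ↔ C = ConjClasses.mk 1 := by
    intro C
    constructor
    · intro h; rw [← hrep C, h]
    · rintro rfl
      have := hrep (ConjClasses.mk 1)
      rw [ConjClasses.mk_eq_mk_iff_isConj, isConj_comm, isConj_one_right] at this
      exact this
  rw [cartanInverse, Matrix.of_apply, sum_eq_sum_conjClasses _ hrep]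
  · congr 1
    rw [← Finset.sum_erase Finset.univ (a := ConjClasses.mk (1 : G))
      (by rw [if_pos ((hrep1 _).mpr rfl), mul_zero])]
    refine Finset.sum_congr rfl fun C hC => ?_
    rw [if_neg fun h => Finset.ne_of_mem_erase hC ((hrep1 C).mp h), character_inv]
    ring
  · intro g h
    have h1 : (h * g * h⁻¹)⁻¹ = h * g⁻¹ * h⁻¹ := by group
    have h2 : h * g * h⁻¹ = 1 ↔ g = 1 := by simp [mul_assoc, mul_eq_one_iff_eq_inv']
    simp only [h1, h2, Representation.char_conj, det_one_sub_conj]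

end Cartan

end ClebschGordan

end

theorem mainTheorem1
    {G : Type*} [Group G] [Finite G]
    {V : Type*} [AddCommGroup V] [Module ℂ V] [FiniteDimensional ℂ V]
    {n : ℕ} {W : Fin (n + 1) → Type*} [∀ i, AddCommGroup (W i)] [∀ i, Module ℂ (W i)]
    [∀ i, FiniteDimensional ℂ (W i)]
    -- the irreducible representations of `G`, the trivial one first
    (ρ : ∀ i, Representation ℂ G (W i)) (hρ : ClebschGordan.IsIrrepList ρ)
    -- representatives of the conjugacy classes of `G`
    [Fintype (ConjClasses G)] [DecidableEq (ConjClasses G)]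
    (rep : ConjClasses G → G) (hrep : ∀ C, ConjClasses.mk (rep C) = C)
    -- a faithful representation whose image acts freely
    (R : Representation ℂ G V) (hfaithful : Function.Injective R)
    (hfree : ∀ g : G, g ≠ 1 → ∀ v : V, R g v = v → v = 0) :
    -- the Euclidean Cartan matrix is invertible
    IsUnit (ClebschGordan.euclideanCartan ρ R) ∧
    -- its inverse as a product of three matrices
    (ClebschGordan.euclideanCartan ρ R)⁻¹ =
      ((Nat.card G : ℂ)⁻¹) •
        ((Matrix.of fun (i : Fin n) (C : {C : ConjClasses G // C ≠ ConjClasses.mk 1}) =>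
            (ρ i.succ).character (rep C) - (Module.finrank ℂ (W i.succ) : ℂ)) *
          Matrix.diagonal (fun C : {C : ConjClasses G // C ≠ ConjClasses.mk 1} =>
            (Nat.card C.1.carrier : ℂ) / LinearMap.det (1 - R (rep C))) *
          (Matrix.of fun (C : {C : ConjClasses G // C ≠ ConjClasses.mk 1}) (j : Fin n) =>
            (starRingEnd ℂ) ((ρ j.succ).character (rep C)) -
              (Module.finrank ℂ (W j.succ) : ℂ))) ∧
    -- the entries of the inverse through characters
    (∀ i j : Fin n, (ClebschGordan.euclideanCartan ρ R)⁻¹ i j =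
      (Nat.card G : ℂ)⁻¹ * ∑ C ∈ Finset.univ.erase (ConjClasses.mk (1 : G)),
        (Nat.card C.carrier : ℂ) *
          ((ρ i.succ).character (rep C) - (Module.finrank ℂ (W i.succ) : ℂ)) *
          ((starRingEnd ℂ) ((ρ j.succ).character (rep C)) - (Module.finrank ℂ (W j.succ) : ℂ)) /
          LinearMap.det (1 - R (rep C))) ∧
    -- the entries of the inverse as residues of combinations of the series `M[R_S(q)]`,
    -- which are the Taylor series of rational functions
    (∃ M : Matrix (Fin (n + 1)) (Fin (n + 1)) (RatFunc ℂ),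
      (∀ i j, ClebschGordan.IsExpansion (M i j) (ClebschGordan.cgSym ρ R i j)) ∧
      ∀ i j : Fin n, (ClebschGordan.euclideanCartan ρ R)⁻¹ i j =
        -((Module.finrank ℂ (W i.succ) : ℂ) * (Module.finrank ℂ (W j.succ) : ℂ)) *
          ClebschGordan.residue 1
            ((M 0 0 - M i.succ 0 / (Module.finrank ℂ (W i.succ) : RatFunc ℂ) -
                M 0 j.succ / (Module.finrank ℂ (W j.succ) : RatFunc ℂ) +
                M i.succ j.succ / ((Module.finrank ℂ (W i.succ) : RatFunc ℂ) *
                  (Module.finrank ℂ (W j.succ) : RatFunc ℂ))) /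
              (1 - RatFunc.X))) ∧
    -- the entries of the inverse as residues of combinations of the polynomials `D[R]`
    (∀ (c : ClebschGordan.CMData ρ R) (i j : Fin n),
      (ClebschGordan.euclideanCartan ρ R)⁻¹ i j =
        -((Module.finrank ℂ (W i.succ) : ℂ) * (Module.finrank ℂ (W j.succ) : ℂ)) *
          ClebschGordan.residue 1
            (((c.numer 0 0 : RatFunc ℂ) -
                (c.numer i.succ 0 : RatFunc ℂ) / (Module.finrank ℂ (W i.succ) : RatFunc ℂ) -
                (c.numer 0 j.succ : RatFunc ℂ) / (Module.finrank ℂ (W j.succ) : RatFunc ℂ) +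
                (c.numer i.succ j.succ : RatFunc ℂ) /
                  ((Module.finrank ℂ (W i.succ) : RatFunc ℂ) *
                    (Module.finrank ℂ (W j.succ) : RatFunc ℂ))) /
              ((1 - RatFunc.X) ^ (Module.finrank ℂ V + 1) * (c.denom : RatFunc ℂ)))) := by
  classical
  let _ : Fintype G := Fintype.ofFinite G
  have hdet : ∀ g, g ≠ 1 → LinearMap.det (1 - R g) ≠ 0 := fun g hg =>
    ClebschGordan.det_one_sub_ne_zero (hfree g hg)
  obtain ⟨hunit, hinv⟩ := ClebschGordan.isUnit_euclideanCartan_and_inv_eq hρ R hfaithful hfree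
  have hres := ClebschGordan.residue_cgRat hρ R hdet
  refine ⟨hunit, ?_, ?_, ⟨ClebschGordan.cgRat ρ R, ClebschGordan.isExpansion_cgRat ρ R, ?_⟩, ?_⟩
  · rw [hinv]
    ext i j
    rw [ClebschGordan.cartanInverse_apply ρ R hrep, Matrix.smul_apply, Matrix.mul_apply,
      smul_eq_mul]
    congr 1
    rw [Finset.sum_subtype (p := fun C => C ≠ ConjClasses.mk 1) _ (fun C => by simp)]
    refine Finset.sum_congr rfl fun C _ => ?_
    rw [Matrix.mul_diagonal, Matrix.of_apply, Matrix.of_apply]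
    ring
  · intro i j
    rw [hinv, ClebschGordan.cartanInverse_apply ρ R hrep]
  · intro i j
    rw [hinv, hres i.succ j.succ]
    rfl
  · intro c i j
    rw [hinv, ClebschGordan.cartanInverse, Matrix.of_apply, ← hres i.succ j.succ]
    simp only [c.cgRat_eq hρ]
    congr 2
    rw [pow_succ]
    simp only [div_eq_mul_inv, mul_inv]
    ring
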